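/- Let $I=[0,1]$, and let $C(I)$ be the space of all continuous maps $I\to I$ with the supremum metric. For an open cover $\alpha$ of $I$ let $N(\alpha)$ be the least cardinality of a subcover of $\alpha$. For $f\in C(I)$ write $f^{-i}(\alpha)=\{(f^i)^{-1}(U):U\in\alpha\}$ and $\alpha\vee\beta=\{U\cap V:U\in\alpha,\ V\in\beta\}$. The topological entropy of $f$ is $$h_{\mathrm{top}}(f)=\sup_{\alpha}\ \lim_{n\to\infty}\frac1n\log N\bigl(\alpha\vee f^{-1}(\alpha)\vee\cdots\vee f^{-(n-1)}(\alpha)\bigr)\in[0,+\infty],$$ where the supremum is over all open covers $\alpha$ of $I$. For $a\in[0,+\infty]$ let $$E_{\ge a}=\{f\in C(I):h_{\mathrm{top}}(f)\ge a\},\quad E_{>a}=\{f\in C(I):h_{\mathrm{top}}(f)>a\},\quad E_{<a}=\{f\in C(I):h_{\mathrm{top}}(f)<a\},$$ with the subspace topology. A subset $A$ of a topological space $X$ is called homotopy dense in $X$ if there is a continuous map $H:X\times[0,1]\to X$ such that $H(x,0)=x$ for every $x\in X$ and $H(x,t)\in A$ for every $x\in X$ and $t\in(0,1]$. Then for every $a\in[0,+\infty)$,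 the sets $E_{\ge a}$ and $E_{>a}$ are homotopy dense in $C(I)$. Moreover, for every $a\in[0,+\infty)$, the set $E_{>a}\cap E_{<+\infty}$ is homotopy dense in $E_{<+\infty}$ and open in $E_{<+\infty}$. -/

import Mathlib

open Set Filter Topology
open scoped ENNReal NNReal unitInterval

namespace TopEntropy

section Covers

variable {X : Type*}

/-- `α` is an open cover of `X`. -/
def IsOpenCover [TopologicalSpace X] (α : Set (Set X)) : Prop :=
  (∀ U ∈ α, IsOpen U) ∧ ⋃₀ α = univ

/-- The least cardinality `N(α)` of a subcover of `α`; on a compact space every open cover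
has a finite subcover, so the set of cardinalities is then nonempty
(see `exists_card_eq_coverNumber`). -/
noncomputable def coverNumber (α : Set (Set X)) : ℕ :=
  sInf {n : ℕ | ∃ s : Finset (Set X), (s : Set (Set X)) ⊆ α ∧ ⋃₀ (s : Set (Set X)) = univ ∧
    s.card = n}

/-- The join `α ∨ β = {U ∩ V : U ∈ α, V ∈ β}`. -/
def join (α β : Set (Set X)) : Set (Set X) :=
  image2 (fun U V => U ∩ V) α β

/-- The pullback `f⁻¹(α) = {f⁻¹(U) : U ∈ α}`. -/
def pullback (f : X → X) (α : Set (Set X)) : Set (Set X) :=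
  (fun U => f ⁻¹' U) '' α

/-- `α ∨ f⁻¹(α) ∨ ⋯ ∨ f⁻⁽ⁿ⁻¹⁾(α)`; the empty join (`n = 0`) is the trivial cover `{X}`. -/
def iterJoin (f : X → X) (α : Set (Set X)) : ℕ → Set (Set X)
  | 0 => {univ}
  | n + 1 => join (iterJoin f α n) (pullback (f^[n]) α)

end Covers

section Entropy

variable {X : Type*} [TopologicalSpace X]

/-- `h_top(f, α) = lim (1/n) log N(α ∨ f⁻¹(α) ∨ ⋯ ∨ f⁻⁽ⁿ⁻¹⁾(α))`. It is written as a `limsup`;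
`tendsto_entropyCover` below shows that it is a genuine limit on a compact space. -/
noncomputable def entropyCover (f : C(X, X)) (α : Set (Set X)) : ℝ≥0∞ :=
  limsup (fun n : ℕ => ENNReal.ofReal (Real.log (coverNumber (iterJoin f α n)) / n)) atTop

/-- The topological entropy of `f`: the supremum of `h_top(f, α)` over all open covers `α`. -/
noncomputable def htop (f : C(X, X)) : ℝ≥0∞ :=
  ⨆ (α : Set (Set X)) (_ : IsOpenCover α), entropyCover f α

end Entropy

section Limit

variable {X : Type*}

lemma coverNumber_le {α : Set (Set X)} (s : Finset (Set X)) (hs : (s : Set (Set X)) ⊆ α)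
    (hc : ⋃₀ (s : Set (Set X)) = univ) : coverNumber α ≤ s.card :=
  Nat.sInf_le ⟨s, hs, hc, rfl⟩

lemma exists_card_eq_coverNumber [TopologicalSpace X] [CompactSpace X] {α : Set (Set X)}
    (hα : IsOpenCover α) : ∃ s : Finset (Set X), (s : Set (Set X)) ⊆ α ∧
      ⋃₀ (s : Set (Set X)) = univ ∧ s.card = coverNumber α := by
  have hne : {n : ℕ | ∃ s : Finset (Set X), (s : Set (Set X)) ⊆ α ∧
      ⋃₀ (s : Set (Set X)) = univ ∧ s.card = n}.Nonempty := by
    obtain ⟨t, ht, hfin, hc⟩ := isCompact_univ.elim_finite_subcover_image (b := α) (c := id)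
      hα.1 (by rw [← hα.2, sUnion_eq_biUnion]; rfl)
    refine ⟨_, hfin.toFinset, by simpa using ht, ?_, rfl⟩
    rw [hfin.coe_toFinset, sUnion_eq_biUnion]
    exact univ_subset_iff.1 hc
  exact Nat.sInf_mem hne

lemma IsOpenCover.join [TopologicalSpace X] {α β : Set (Set X)} (hα : IsOpenCover α)
    (hβ : IsOpenCover β) : IsOpenCover (join α β) := by
  refine ⟨?_, eq_univ_of_forall fun x => ?_⟩
  · rintro _ ⟨U, hU, V, hV, rfl⟩
    exact (hα.1 U hU).inter (hβ.1 V hV)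
  · obtain ⟨U, hU, hxU⟩ : x ∈ ⋃₀ α := hα.2 ▸ mem_univ x
    obtain ⟨V, hV, hxV⟩ : x ∈ ⋃₀ β := hβ.2 ▸ mem_univ x
    exact ⟨U ∩ V, ⟨U, hU, V, hV, rfl⟩, hxU, hxV⟩

lemma IsOpenCover.pullback [TopologicalSpace X] {α : Set (Set X)} (hα : IsOpenCover α)
    {f : X → X} (hf : Continuous f) : IsOpenCover (pullback f α) := by
  refine ⟨?_, eq_univ_of_forall fun x => ?_⟩
  · rintro _ ⟨U, hU, rfl⟩
    exact (hα.1 U hU).preimage hf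
  · obtain ⟨U, hU, hxU⟩ : f x ∈ ⋃₀ α := hα.2 ▸ mem_univ (f x)
    exact ⟨f ⁻¹' U, ⟨U, hU, rfl⟩, hxU⟩

lemma IsOpenCover.iterJoin [TopologicalSpace X] {α : Set (Set X)} (hα : IsOpenCover α)
    {f : X → X} (hf : Continuous f) (n : ℕ) : IsOpenCover (iterJoin f α n) := by
  induction n with
  | zero => exact ⟨by simp [TopEntropy.iterJoin], by simp [TopEntropy.iterJoin]⟩
  | succ n ih => exact ih.join (hα.pullback (hf.iterate n))

lemma iterJoin_add (f : X → X) (α : Set (Set X)) (m n : ℕ) :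
    iterJoin f α (m + n) = join (iterJoin f α m) (pullback f^[m] (iterJoin f α n)) := by
  induction n with
  | zero => simp [iterJoin, join, pullback]
  | succ n ih =>
    have h1 : pullback f^[m] (iterJoin f α (n + 1)) =
        join (pullback f^[m] (iterJoin f α n)) (pullback f^[m + n] α) := by
      simp only [iterJoin, join, pullback, image_image2, image2_image_left, image2_image_right]
      rw [Nat.add_comm m n, Function.iterate_add]
      rfl
    rw [h1, ← Nat.add_assoc, iterJoin, ih]
    exact image2_assoc fun a b c => inter_assoc a b c

lemma coverNumber_join_le [TopologicalSpace X] [CompactSpace X] {α β : Set (Set X)}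
    (hα : IsOpenCover α) (hβ : IsOpenCover β) :
    coverNumber (join α β) ≤ coverNumber α * coverNumber β := by
  classical
  obtain ⟨s, hs, hsc, hsn⟩ := exists_card_eq_coverNumber hα
  obtain ⟨t, ht, htc, htn⟩ := exists_card_eq_coverNumber hβ
  rw [← hsn, ← htn]
  refine (coverNumber_le (Finset.image₂ (fun U V => U ∩ V) s t) ?_ ?_).trans
    (Finset.card_image₂_le _ _ _)
  · rw [Finset.coe_image₂]
    exact image2_subset hs ht
  · refine eq_univ_of_forall fun x => ?_
    obtain ⟨U, hU, hxU⟩ : x ∈ ⋃₀ (s : Set (Set X)) := hsc ▸ mem_univ x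
    obtain ⟨V, hV, hxV⟩ : x ∈ ⋃₀ (t : Set (Set X)) := htc ▸ mem_univ x
    exact ⟨U ∩ V, by rw [Finset.coe_image₂]; exact ⟨U, hU, V, hV, rfl⟩, hxU, hxV⟩

lemma coverNumber_pullback_le [TopologicalSpace X] [CompactSpace X] {α : Set (Set X)}
    (hα : IsOpenCover α) (f : X → X) : coverNumber (pullback f α) ≤ coverNumber α := by
  classical
  obtain ⟨s, hs, hsc, hsn⟩ := exists_card_eq_coverNumber hα
  rw [← hsn]
  refine (coverNumber_le (s.image (fun U => f ⁻¹' U)) ?_ ?_).trans Finset.card_image_le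
  · rw [Finset.coe_image]
    exact image_mono hs
  · refine eq_univ_of_forall fun x => ?_
    obtain ⟨U, hU, hxU⟩ : f x ∈ ⋃₀ (s : Set (Set X)) := hsc ▸ mem_univ (f x)
    exact ⟨f ⁻¹' U, by rw [Finset.coe_image]; exact ⟨U, hU, rfl⟩, hxU⟩

lemma coverNumber_pos [TopologicalSpace X] [CompactSpace X] [Nonempty X] {α : Set (Set X)}
    (hα : IsOpenCover α) : 0 < coverNumber α := by
  obtain ⟨s, -, hsc, hsn⟩ := exists_card_eq_coverNumber hα
  rw [← hsn, Finset.card_pos]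
  by_contra h
  rw [Finset.not_nonempty_iff_eq_empty] at h
  rw [h, Finset.coe_empty, sUnion_empty] at hsc
  exact empty_ne_univ hsc

/-- The limit in the definition of `h_top(f, α)` exists. -/
theorem tendsto_entropyCover [TopologicalSpace X] [CompactSpace X] [Nonempty X] (f : C(X, X))
    {α : Set (Set X)} (hα : IsOpenCover α) :
    Tendsto (fun n : ℕ => ENNReal.ofReal (Real.log (coverNumber (iterJoin f α n)) / n)) atTop
      (𝓝 (entropyCover f α)) := by
  have hsub : Subadditive fun n : ℕ => Real.log (coverNumber (iterJoin f α n)) := by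
    intro m n
    have hc := fun k => hα.iterJoin f.continuous k
    have hp := fun k => coverNumber_pos (hc k)
    have hle : coverNumber (iterJoin f α (m + n)) ≤
        coverNumber (iterJoin f α m) * coverNumber (iterJoin f α n) := by
      rw [iterJoin_add]
      exact (coverNumber_join_le (hc m) ((hc n).pullback (f.continuous.iterate m))).trans
        (Nat.mul_le_mul_left _ (coverNumber_pullback_le (hc n) _))
    rw [← Real.log_mul (by exact_mod_cast (hp m).ne') (by exact_mod_cast (hp n).ne')]
    exact Real.log_le_log (by exact_mod_cast hp (m + n)) (by exact_mod_cast hle)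
  have hbdd : BddBelow (range fun n : ℕ => Real.log (coverNumber (iterJoin f α n)) / n) := by
    refine ⟨0, ?_⟩
    rintro _ ⟨n, rfl⟩
    positivity
  have h := ENNReal.tendsto_ofReal (hsub.tendsto_lim hbdd)
  rw [entropyCover, h.limsup_eq]
  exact h

end Limit

/-- A subset `A` of a space `X` is homotopy dense if there is a homotopy `H : X × [0,1] → X`
with `H₀ = id` and `H_t(x) ∈ A` for all `x ∈ X` and `t ∈ (0,1]`. -/
def HomotopyDense {X : Type*} [TopologicalSpace X] (A : Set X) : Prop :=
  ∃ H : C(X × I, X), (∀ x, H (x, 0) = x) ∧ ∀ x, ∀ t : I, 0 < t → H (x, t) ∈ A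

/-- `E_{≥ a}`. The topology on `C(I, I)` is that of the supremum metric. -/
def Ege (a : ℝ≥0∞) : Set C(I, I) := {f | a ≤ htop f}

/-- `E_{> a}`. -/
def Egt (a : ℝ≥0∞) : Set C(I, I) := {f | a < htop f}

/-- `E_{< a}`; in particular `Elt ∞` is the set of interval maps of finite entropy. -/
def Elt (a : ℝ≥0∞) : Set C(I, I) := {f | htop f < a}

end TopEntropy

/-! One homotopy serves all the density claims. For `t > 0`, replace `f` by its infimal convolution
with slope `1/t`, which is Lipschitz and tends to `f` as `t → 0`, add an oscillation of amplitude
`4t` and wavelength of order `t ^ 2`, and clip to `I`. The regularized map has a fixed point and,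
within `t ^ 2` of it, strays at most `t` from it, so every half-wave there stretches across an
interval of length `t ^ 2`. This gives a horseshoe with as many branches as desired, the same number
for all `f` and `t` (`log_le_htop_wiggle`). The new map is Lipschitz, hence of finite entropy
(`htop_lt_top_of_lipschitz`).

Openness is lower semicontinuity of entropy (Misiurewicz), `isOpen_Egt`. If the entropy of `f`
exceeds `a`, some iterate `F = f^[k]` has cover numbers growing much faster than `exp (a * k)` per
step. Cut `I` into small cells and count itineraries. The image of an interval is an interval, so it
meets at most two cells without containing them; partial coverings alone grow at rate at most 2, and
faster growth forces complete ones. By pigeonhole some cell covers itself more than `exp (a * k *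
n)` times in `n` steps (`exists_fullCount_self_ge`). Dropping two branches leaves a horseshoe given
by finitely many strict inequalities (`exists_strict_horseshoe`). It survives perturbation and
forces entropy above `a` by `le_htop_of_horseshoe`. -/

namespace TopEntropy

/-! ### Members of the iterated join as cylinder sets -/

section Cylinders

variable {X : Type*}

lemma exists_mem_iterJoin (f : X → X) {α : Set (Set X)} (U : ℕ → Set X) (hU : ∀ i, U i ∈ α)
    (n : ℕ) : ∃ V ∈ iterJoin f α n, ∀ x, (∀ i < n, f^[i] x ∈ U i) → x ∈ V := by
  induction n with
  | zero => exact ⟨univ, rfl, fun x _ => mem_univ x⟩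
  | succ n ih =>
    obtain ⟨V, hV, h⟩ := ih
    exact ⟨V ∩ f^[n] ⁻¹' U n, ⟨V, hV, _, ⟨U n, hU n, rfl⟩, rfl⟩, fun x hx =>
      ⟨h x fun i hi => hx i (hi.trans n.lt_succ_self), hx n n.lt_succ_self⟩⟩

lemma subset_preimage_of_mem_iterJoin {f : X → X} {α : Set (Set X)} {n : ℕ} {V : Set X}
    (hV : V ∈ iterJoin f α n) {i : ℕ} (hi : i < n) : ∃ U ∈ α, V ⊆ f^[i] ⁻¹' U := by
  induction n generalizing V with
  | zero => omega
  | succ n ih =>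
    obtain ⟨V', hV', _, ⟨U, hU, rfl⟩, rfl⟩ := hV
    rcases Nat.lt_succ_iff_lt_or_eq.1 hi with h | rfl
    · obtain ⟨U', hU', h'⟩ := ih hV' h
      exact ⟨U', hU', inter_subset_left.trans h'⟩
    · exact ⟨U, hU, inter_subset_right⟩

/-- Allows passing to `f^[k]`: its iterated joins with the refined cover are iterated joins of `f`
itself. -/
lemma iterJoin_iterate (f : X → X) (α : Set (Set X)) (k m : ℕ) :
    iterJoin f^[k] (iterJoin f α k) m = iterJoin f α (k * m) := by
  induction m with
  | zero => rfl
  | succ m ih => rw [iterJoin, ih, Nat.mul_succ, iterJoin_add, ← Function.iterate_mul]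

end Cylinders

/-! ### Horseshoes force entropy -/

section LowerBound

variable {X : Type*} {ι : Type*}

/-- The orbit is built backwards, by taking a preimage in the first set of a point that already
follows the shifted word. -/
lemma exists_orbit_through {G : X → X} {K : ι → Set X} (hne : ∀ i, (K i).Nonempty)
    (hK : ∀ i j, K j ⊆ G '' K i) (m : ℕ) (v : ℕ → ι) :
    ∃ z, ∀ j ≤ m, G^[j] z ∈ K (v j) := by
  induction m generalizing v with
  | zero =>
    obtain ⟨z, hz⟩ := hne (v 0)
    refine ⟨z, fun j hj => ?_⟩
    obtain rfl : j = 0 := by omega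
    exact hz
  | succ m ih =>
    obtain ⟨z, hz⟩ := ih fun j => v (j + 1)
    obtain ⟨y, hy, hyz⟩ := hK (v 0) (v 1) (hz 0 (Nat.zero_le _))
    refine ⟨y, fun j hj => ?_⟩
    cases j with
    | zero => exact hy
    | succ j =>
      rw [Function.iterate_succ_apply, hyz]
      exact hz j (by omega)

/-- A closed, pairwise disjoint family each of whose members is mapped by `g^[n]` onto every
member forces entropy `log (card ι) / n`. -/
theorem le_htop_of_horseshoe [TopologicalSpace X] [CompactSpace X] [Fintype ι] [Nonempty ι]
    (g : C(X, X)) (K : ι → Set X) (hcl : ∀ i, IsClosed (K i)) (hne : ∀ i, (K i).Nonempty)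
    (hd : Pairwise fun i j => Disjoint (K i) (K j)) {n : ℕ} (hn : 0 < n)
    (hK : ∀ i j, K j ⊆ g^[n] '' K i) :
    ENNReal.ofReal (Real.log (Fintype.card ι) / n) ≤ htop g := by
  classical
  have : Nonempty X := ⟨(hne (Classical.arbitrary ι)).some⟩
  -- A point of `K j` lies in `U j` and in no other `U i`, so the cover reads off the letter.
  set U : ι → Set X := fun i => (⋃ j ∈ {j | j ≠ i}, K j)ᶜ with hUdef
  have hUmem : ∀ i j x, x ∈ U i → x ∈ K j → j = i := by
    intro i j x hx hxj
    by_contra hji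
    exact hx (mem_biUnion (x := j) hji hxj)
  have hα : IsOpenCover (range U) := by
    refine ⟨?_, eq_univ_of_forall fun x => ?_⟩
    · rintro _ ⟨i, rfl⟩
      exact ((toFinite _).isClosed_biUnion fun j _ => hcl j).isOpen_compl
    · by_cases hx : ∃ i, x ∈ K i
      · obtain ⟨i, hi⟩ := hx
        refine ⟨U i, mem_range_self i, fun h => ?_⟩
        obtain ⟨j, hj, hxj⟩ := mem_iUnion₂.1 h
        exact disjoint_left.1 (hd hj) hxj hi
      · refine ⟨_, mem_range_self (Classical.arbitrary ι), fun h => ?_⟩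
        obtain ⟨j, -, hxj⟩ := mem_iUnion₂.1 h
        exact hx ⟨j, hxj⟩
  have hcount : ∀ m : ℕ, Fintype.card ι ^ m ≤ coverNumber (iterJoin g (range U) (n * m)) := by
    intro m
    obtain ⟨s, hs, hsc, hsn⟩ :=
      exists_card_eq_coverNumber (hα.iterJoin g.continuous (n * m))
    rw [← hsn]
    have hz : ∀ v : Fin m → ι, ∃ z, ∀ j : Fin m, g^[n * j] z ∈ K (v j) := by
      intro v
      obtain ⟨z, hz⟩ := exists_orbit_through (G := g^[n]) hne hK m
        fun j => if h : j < m then v ⟨j, h⟩ else Classical.arbitrary ι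
      refine ⟨z, fun j => ?_⟩
      have := hz j j.2.le
      rwa [dif_pos j.2, ← Function.iterate_mul] at this
    choose z hz using hz
    have hV : ∀ v, ∃ V ∈ s, z v ∈ V := fun v => by
      have : z v ∈ ⋃₀ (s : Set (Set X)) := hsc ▸ mem_univ _
      exact this
    choose V hVs hzV using hV
    have hinj : Function.Injective V := by
      intro v w hvw
      funext j
      -- A member of the join fixes one `U i` at time `n * j`, so two words sharing that member
      -- agree at `j`.
      obtain ⟨_, ⟨i, rfl⟩, hi⟩ := subset_preimage_of_mem_iterJoin (hs (hVs v))
        (i := n * j) (Nat.mul_lt_mul_of_pos_left j.2 hn)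
      rw [hUmem i _ _ (hi (hzV v)) (hz v j), hUmem i _ _ (hi (hvw ▸ hzV w)) (hz w j)]
    calc Fintype.card ι ^ m = (Finset.univ : Finset (Fin m → ι)).card := by simp
      _ ≤ s.card := Finset.card_le_card_of_injOn V (fun v _ => hVs v) hinj.injOn
  refine le_trans ?_ (le_iSup₂ (f := fun α (_ : IsOpenCover α) => entropyCover g α) _ hα)
  have hlim := (tendsto_entropyCover g hα).comp
    (tendsto_id.const_mul_atTop' hn : Tendsto (fun m : ℕ => n * m) atTop atTop)
  refine ge_of_tendsto hlim (eventually_atTop.2 ⟨1, fun m hm => ENNReal.ofReal_le_ofReal ?_⟩)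
  have hm' : (0 : ℝ) < m := by exact_mod_cast hm
  have hn' : (0 : ℝ) < n := by exact_mod_cast hn
  have hp : (0 : ℝ) < Fintype.card ι := by exact_mod_cast Fintype.card_pos
  have h1 : (m : ℝ) * Real.log (Fintype.card ι) ≤
      Real.log (coverNumber (iterJoin g (range U) (n * m))) := by
    rw [← Real.log_pow]
    exact Real.log_le_log (by positivity) (by exact_mod_cast hcount m)
  rw [Nat.cast_mul, div_le_div_iff₀ hn' (by positivity)]
  calc Real.log (Fintype.card ι) * (n * m) = (m * Real.log (Fintype.card ι)) * n := by ring
    _ ≤ _ := by gcongr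

end LowerBound

/-! ### Lipschitz maps have finite entropy -/

section UpperBound

lemma exists_nat_dist_lt (x : I) {r : ℝ} (hr : 0 < r) :
    ∃ j ∈ Finset.range (⌊1 / r⌋₊ + 1), |(x : ℝ) - j * r| < r := by
  refine ⟨⌊(x : ℝ) / r⌋₊, ?_, ?_⟩
  · rw [Finset.mem_range, Nat.lt_succ_iff]
    exact Nat.floor_le_floor (by gcongr; exact x.2.2)
  · have h1 := Nat.floor_le (div_nonneg x.2.1 hr.le)
    have h2 := Nat.lt_floor_add_one ((x : ℝ) / r)
    rw [le_div_iff₀ hr] at h1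
    rw [div_lt_iff₀ hr] at h2
    rw [abs_lt]
    constructor <;> linarith

/-- Points within `δ / L ^ n` stay `δ`-close for `n` steps, so `O(L ^ n)` cylinders cover `I` and
the entropy is at most `log L`. -/
theorem htop_lt_top_of_lipschitz {f : C(I, I)} {L : ℝ≥0} (hf : LipschitzWith L f) :
    htop f < ∞ := by
  wlog hL : 1 ≤ L generalizing L
  · exact this (hf.weaken (le_max_left L 1)) (le_max_right L 1)
  have hL0 : (0 : ℝ) < L := by exact_mod_cast zero_lt_one.trans_le hL
  refine lt_of_le_of_lt (iSup₂_le fun α hα => ?_) (ENNReal.ofReal_lt_top (r := Real.log L))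
  obtain ⟨δ, hδ, hleb⟩ := lebesgue_number_lemma_of_metric_sUnion isCompact_univ hα.1 hα.2.ge
  have hcount : ∀ n : ℕ, (coverNumber (iterJoin f α n) : ℝ) ≤ (1 / δ + 1) * L ^ n := by
    intro n
    classical
    set r : ℝ := δ / L ^ n with hr
    have hr0 : 0 < r := by positivity
    have hc : ∀ j : ℕ, ∃ V ∈ iterJoin f α n, ∀ x : I, |(x : ℝ) - j * r| < r → x ∈ V := by
      intro j
      have hU : ∀ i : ℕ, ∃ U ∈ α, i < n → ∀ x : I, |(x : ℝ) - j * r| < r → f^[i] x ∈ U := by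
        intro i
        -- The centre `j * r` may fall outside `I` for large `j`; projecting does not increase its
        -- distance to points of `I`.
        set c : I := projIcc 0 1 zero_le_one (j * r)
        obtain ⟨U, hU, hball⟩ := hleb (f^[i] c) (mem_univ _)
        refine ⟨U, hU, fun hi x hx => hball ?_⟩
        have hxc : dist x c ≤ |(x : ℝ) - j * r| := by
          have := (LipschitzWith.projIcc (zero_le_one' ℝ)).dist_le_mul (x : ℝ) (j * r)
          rwa [projIcc_val, NNReal.coe_one, one_mul, Real.dist_eq] at this
        rw [Metric.mem_ball]
        calc dist (f^[i] x) (f^[i] c) ≤ (L ^ i : ℝ≥0) * dist x c := (hf.iterate i).dist_le_mul x c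
          _ < (L ^ i : ℝ≥0) * r := by
            gcongr
            exact hxc.trans_lt hx
          _ ≤ L ^ n * r := by
            push_cast
            gcongr
          _ = δ := by rw [hr]; field_simp
      choose U hUα hU using hU
      obtain ⟨V, hV, h⟩ := exists_mem_iterJoin f U hUα n
      exact ⟨V, hV, fun x hx => h x fun i hi => hU i hi x hx⟩
    choose V hV hVx using hc
    have := coverNumber_le ((Finset.range (⌊1 / r⌋₊ + 1)).image V)
      (α := iterJoin f α n) (by
        rw [Finset.coe_image]
        rintro _ ⟨j, -, rfl⟩
        exact hV j) (eq_univ_of_forall fun x => by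
          obtain ⟨j, hj, hx⟩ := exists_nat_dist_lt x hr0
          exact ⟨V j, Finset.mem_coe.2 (Finset.mem_image_of_mem V hj), hVx j x hx⟩)
    have h2 := this.trans Finset.card_image_le
    rw [Finset.card_range] at h2
    calc (coverNumber (iterJoin f α n) : ℝ) ≤ ⌊1 / r⌋₊ + 1 := by exact_mod_cast h2
      _ ≤ 1 / r + 1 := by gcongr; exact Nat.floor_le (by positivity)
      _ = 1 / δ * L ^ n + 1 := by rw [hr]; field_simp
      _ ≤ 1 / δ * L ^ n + L ^ n := by
        gcongr
        exact one_le_pow₀ (by exact_mod_cast hL)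
      _ = _ := by ring
  have hlim : Tendsto (fun n : ℕ => ENNReal.ofReal (Real.log (1 / δ + 1) / n + Real.log L)) atTop
      (𝓝 (ENNReal.ofReal (Real.log L))) := by
    refine ENNReal.tendsto_ofReal ?_
    simpa using (tendsto_const_div_atTop_nhds_zero_nat (Real.log (1 / δ + 1))).add_const
      (Real.log L)
  refine le_of_tendsto_of_tendsto (tendsto_entropyCover f hα) hlim
    (eventually_atTop.2 ⟨1, fun n hn => ENNReal.ofReal_le_ofReal ?_⟩)
  have hn' : (0 : ℝ) < n := by exact_mod_cast hn
  have hpos : (0 : ℝ) < coverNumber (iterJoin f α n) := by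
    exact_mod_cast coverNumber_pos (hα.iterJoin f.continuous n)
  have h1 := Real.log_le_log hpos (hcount n)
  rw [Real.log_mul (by positivity) (by positivity), Real.log_pow] at h1
  calc Real.log (coverNumber (iterJoin f α n)) / n ≤ (Real.log (1 / δ + 1) + n * Real.log L) / n := by
        gcongr
    _ = _ := by field_simp

end UpperBound

end TopEntropy

namespace TopEntropy

/-! ### Lipschitz regularization by infimal convolution -/

section Regularization

/-- The infimal convolution of `f` with `L * |·|`. -/
noncomputable def infConv (f : C(I, I)) (L : ℝ) (x : I) : ℝ :=
  ⨅ y : I, ((f y : ℝ) + L * |(x : ℝ) - y|)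

lemma abs_sub_le_one (x y : I) : |(x : ℝ) - y| ≤ 1 :=
  abs_le.2 ⟨by linarith [x.2.1, y.2.2], by linarith [x.2.2, y.2.1]⟩

lemma infConv_le (f : C(I, I)) {L : ℝ} (hL : 0 ≤ L) (x y : I) :
    infConv f L x ≤ f y + L * |(x : ℝ) - y| := by
  refine ciInf_le ⟨0, ?_⟩ y
  rintro _ ⟨z, rfl⟩
  have := (f z).2.1
  positivity

lemma infConv_le_self (f : C(I, I)) {L : ℝ} (hL : 0 ≤ L) (x : I) : infConv f L x ≤ f x := by
  simpa using infConv_le f hL x x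

lemma infConv_nonneg (f : C(I, I)) {L : ℝ} (hL : 0 ≤ L) (x : I) : 0 ≤ infConv f L x := by
  refine le_ciInf fun z => ?_
  have := (f z).2.1
  positivity

/-- One estimate yields joint continuity in the map, the slope and the point; the slopes enter only
through `|L - M|` because `I` has diameter 1. -/
lemma abs_infConv_sub_le (f g : C(I, I)) {L M : ℝ} (hL : 0 ≤ L) (hM : 0 ≤ M) (x y : I) :
    |infConv f L x - infConv g M y| ≤ dist f g + |L - M| + M * |(x : ℝ) - y| := by
  have hd : ∀ z, |(f z : ℝ) - g z| ≤ dist f g := fun z =>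
    ContinuousMap.dist_apply_le_dist (f := f) (g := g) z
  have htri : ∀ z : I, |(x : ℝ) - z| ≤ |(x : ℝ) - y| + |(y : ℝ) - z| := fun z => abs_sub_le _ _ _
  have htri' : ∀ z : I, |(y : ℝ) - z| ≤ |(x : ℝ) - y| + |(x : ℝ) - z| := fun z => by
    rw [abs_sub_comm (x : ℝ) y]; exact abs_sub_le _ _ _
  have hLM : ∀ z : I, abs (L * |(x : ℝ) - z| - M * |(x : ℝ) - z|) ≤ |L - M| := fun z => by
    rw [← sub_mul, abs_mul, abs_abs]
    exact mul_le_of_le_one_right (abs_nonneg _) (abs_sub_le_one x z)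
  rw [abs_le]
  constructor
  · rw [neg_le_sub_iff_le_add, ← sub_le_iff_le_add]
    refine le_ciInf fun z => ?_
    have h1 := infConv_le g hM y z
    have h2 := mul_le_mul_of_nonneg_left (htri' z) hM
    linarith [(abs_le.1 (hd z)).1, (abs_le.1 (hLM z)).1]
  · rw [sub_le_comm]
    refine le_ciInf fun z => ?_
    have h1 := infConv_le f hL x z
    have h2 := mul_le_mul_of_nonneg_left (htri z) hM
    linarith [(abs_le.1 (hd z)).2, (abs_le.1 (hLM z)).2]

/-- A competitor at distance `δ` or more pays at least `L * δ ≥ 1 ≥ f x`; a nearer one gains at most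
`ε`. -/
lemma sub_le_infConv (f : C(I, I)) {L δ ε : ℝ} {x : I} (hε : 0 ≤ ε) (hL : 0 ≤ L) (hLδ : 1 ≤ L * δ)
    (hδ : ∀ y : I, |(x : ℝ) - y| < δ → |(f x : ℝ) - f y| ≤ ε) : f x - ε ≤ infConv f L x := by
  refine le_ciInf fun y => ?_
  rcases lt_or_ge |(x : ℝ) - y| δ with h | h
  · have := (abs_le.1 (hδ y h)).2
    have h2 : 0 ≤ L * |(x : ℝ) - y| := by positivity
    linarith
  · have h2 := mul_le_mul_of_nonneg_left h hL
    linarith [(f x).2.2, (f y).2.1]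

lemma continuous_infConv {Y : Type*} [TopologicalSpace Y] {f : Y → C(I, I)} {L : Y → ℝ} {x : Y → I}
    (hf : Continuous f) (hL : Continuous L) (hx : Continuous x) (hL0 : ∀ p, 0 ≤ L p) :
    Continuous fun p => infConv (f p) (L p) (x p) := by
  refine continuous_iff_continuousAt.2 fun p => tendsto_iff_dist_tendsto_zero.2 ?_
  refine squeeze_zero (fun q => dist_nonneg)
    (fun q => abs_infConv_sub_le (f q) (f p) (hL0 q) (hL0 p) (x q) (x p)) ?_
  have : Continuous fun q => dist (f q) (f p) + |L q - L p| + L p * |(x q : ℝ) - x p| := by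
    fun_prop
  simpa using this.tendsto p

end Regularization

/-! ### The oscillating homotopy and its horseshoes -/

section Homotopy

/-- The infimal convolution of `f` at slope `t⁻¹`, plus a rapid oscillation of amplitude `4 * t`
with `N` half-periods in every interval of length `t ^ 2`. -/
noncomputable def wiggleVal (N : ℕ) (f : C(I, I)) (t : ℝ) (x : I) : ℝ :=
  infConv f t⁻¹ x + 4 * t * Real.cos (N * x / t ^ 2 * Real.pi)

lemma abs_wiggleVal_sub_le (N : ℕ) (f : C(I, I)) {t : ℝ} (ht : 0 < t) (x y : I) :
    |wiggleVal N f t x - wiggleVal N f t y| ≤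
      (t⁻¹ + 4 * t * (N / t ^ 2 * Real.pi)) * |(x : ℝ) - y| := by
  have h1 := abs_infConv_sub_le f f (inv_pos.2 ht).le (inv_pos.2 ht).le x y
  have h2 := Real.abs_cos_sub_cos_le (N * x / t ^ 2 * Real.pi) (N * y / t ^ 2 * Real.pi)
  rw [show N * (x : ℝ) / t ^ 2 * Real.pi - N * y / t ^ 2 * Real.pi =
    N / t ^ 2 * Real.pi * (x - y) by ring, abs_mul,
    abs_of_nonneg (show 0 ≤ N / t ^ 2 * Real.pi by positivity)] at h2
  simp only [dist_self, sub_self, abs_zero, zero_add] at h1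
  unfold wiggleVal
  calc _ = |(infConv f t⁻¹ x - infConv f t⁻¹ y) + 4 * t * (Real.cos (N * x / t ^ 2 * Real.pi) -
        Real.cos (N * y / t ^ 2 * Real.pi))| := by ring_nf
    _ ≤ t⁻¹ * |(x : ℝ) - y| + 4 * t * (N / t ^ 2 * Real.pi * |(x : ℝ) - y|) := by
      refine (abs_add_le _ _).trans (add_le_add h1 ?_)
      rw [abs_mul, abs_of_pos (show 0 < 4 * t by positivity)]
      gcongr
    _ = _ := by ring

lemma continuous_wiggleVal (N : ℕ) (f : C(I, I)) {t : ℝ} (ht : 0 < t) :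
    Continuous (wiggleVal N f t) := by
  have := continuous_infConv (f := fun _ : I => f) (L := fun _ => t⁻¹) (x := id)
    continuous_const continuous_const continuous_id fun _ => (inv_pos.2 ht).le
  unfold wiggleVal
  fun_prop

open Classical in
/-- The homotopy from the identity of `C(I, I)` to Lipschitz maps of large entropy. -/
noncomputable def wiggle (N : ℕ) (p : C(I, I) × I) : C(I, I) :=
  if h : 0 < p.2 then
    ⟨fun x => projIcc 0 1 zero_le_one (wiggleVal N p.1 p.2 x),
      continuous_projIcc.comp (continuous_wiggleVal N p.1 h)⟩
  else p.1

lemma wiggle_zero (N : ℕ) (f : C(I, I)) : wiggle N (f, 0) = f := by simp [wiggle]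

lemma wiggle_apply (N : ℕ) (f : C(I, I)) {t : I} (ht : 0 < t) (x : I) :
    wiggle N (f, t) x = projIcc 0 1 zero_le_one (wiggleVal N f t x) := by simp [wiggle, ht]

lemma dist_wiggle_apply_le (N : ℕ) (f : C(I, I)) {t : I} (ht : 0 < t) (x y : I) :
    dist (wiggle N (f, t) x) y ≤ |wiggleVal N f t x - y| := by
  have := (LipschitzWith.projIcc (zero_le_one' ℝ)).dist_le_mul (wiggleVal N f t x) y
  rwa [projIcc_val, NNReal.coe_one, one_mul, Real.dist_eq, ← wiggle_apply N f ht] at this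

lemma lipschitz_wiggle (N : ℕ) (f : C(I, I)) {t : I} (ht : 0 < t) :
    ∃ L, LipschitzWith L (wiggle N (f, t)) := by
  have ht' : (0 : ℝ) < t := ht
  refine ⟨⟨(t : ℝ)⁻¹ + 4 * t * (N / (t : ℝ) ^ 2 * Real.pi), by positivity⟩,
    LipschitzWith.of_dist_le_mul fun x y => ?_⟩
  rw [wiggle_apply N f ht, wiggle_apply N f ht]
  refine ((LipschitzWith.projIcc (zero_le_one' ℝ)).dist_le_mul _ _).trans ?_
  rw [NNReal.coe_one, one_mul]
  exact abs_wiggleVal_sub_le N f ht' x y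

lemma continuous_wiggle (N : ℕ) : Continuous (wiggle N) := by
  refine continuous_iff_continuousAt.2 fun ⟨f, t⟩ => ?_
  rcases eq_or_lt_of_le (show (0 : I) ≤ t from t.2.1) with h0 | h0
  · subst h0
    rw [Metric.continuousAt_iff', wiggle_zero]
    intro ε hε
    obtain ⟨δ, hδ, hfδ⟩ := Metric.uniformContinuous_iff.1
      (CompactSpace.uniformContinuous_of_continuous f.continuous) (ε / 4) (by positivity)
    have h1 : ∀ᶠ p : C(I, I) × I in 𝓝 (f, 0), dist p.1 f < ε / 4 :=
      (continuous_fst.tendsto (f, (0 : I))).eventually (Metric.ball_mem_nhds f (by positivity))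
    -- Below `ε / 16` the oscillation is under `ε / 4`; below `δ` the slope `t⁻¹` satisfies `t⁻¹ * δ
    -- ≥ 1`.
    have h2 : ∀ᶠ p : C(I, I) × I in 𝓝 (f, 0), (p.2 : ℝ) < min δ (ε / 16) := by
      have hc : Continuous fun p : C(I, I) × I => (p.2 : ℝ) := by fun_prop
      refine (hc.tendsto (f, (0 : I))).eventually (Iio_mem_nhds ?_)
      simp only [Icc.coe_zero]
      positivity
    filter_upwards [h1, h2] with ⟨g, t⟩ hg ht
    simp only at hg ht
    rcases eq_or_lt_of_le (show (0 : I) ≤ t from t.2.1) with h0 | h0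
    · subst h0
      rw [wiggle_zero]
      linarith
    · have ht' : (0 : ℝ) < t := h0
      have hti : 0 ≤ (t : ℝ)⁻¹ := by positivity
      refine (ContinuousMap.dist_lt_iff hε).2 fun x => ?_
      -- The modulus of continuity is that of the fixed `f`; the nearby `g` is compared with it
      -- through `infConv`, at cost `dist g f`.
      have hlow := sub_le_infConv f (L := (t : ℝ)⁻¹) (δ := δ) (ε := ε / 4) (x := x) (by positivity)
        hti (by rw [inv_mul_eq_div, one_le_div ht']; exact (ht.trans_le (min_le_left _ _)).le)
        (fun y hy => (hfδ (a := x) (b := y) hy).le)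
      have hup := infConv_le_self f hti x
      have hgf := abs_le.1 (abs_infConv_sub_le g f hti hti x x)
      simp only [sub_self, abs_zero, mul_zero, add_zero] at hgf
      have hcos := abs_le.1 (Real.abs_cos_le_one (N * x / (t : ℝ) ^ 2 * Real.pi))
      have ht16 := ht.trans_le (min_le_right _ _)
      have hgx := (abs_le.1 (ContinuousMap.dist_apply_le_dist (f := g) (g := f) x))
      refine (dist_wiggle_apply_le N g h0 x (f x)).trans_lt ?_
      rw [abs_lt, wiggleVal]
      constructor <;> nlinarith
  · have hopen : IsOpen {p : C(I, I) × I | 0 < p.2} := isOpen_lt continuous_const continuous_snd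
    refine ContinuousOn.continuousAt (s := {p | 0 < p.2}) ?_ (hopen.mem_nhds h0)
    rw [continuousOn_iff_continuous_domRestrict]
    refine ContinuousMap.continuous_of_continuous_uncurry _ ?_
    have hc : Continuous fun q : {p : C(I, I) × I | 0 < p.2} × I =>
        wiggleVal N q.1.1.1 q.1.1.2 q.2 := by
      have hne : ∀ q : {p : C(I, I) × I | 0 < p.2} × I, (q.1.1.2 : ℝ) ≠ 0 := fun q =>
        (show (0 : ℝ) < q.1.1.2 from q.1.2).ne'
      have h1 := continuous_infConv
        (f := fun q : {p : C(I, I) × I | 0 < p.2} × I => q.1.1.1)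
        (L := fun q => (q.1.1.2 : ℝ)⁻¹) (x := fun q => q.2) (by fun_prop)
        (Continuous.inv₀ (by fun_prop) hne) (by fun_prop)
        (fun q => inv_nonneg.2 q.1.1.2.2.1)
      have h2 : Continuous fun q : {p : C(I, I) × I | 0 < p.2} × I =>
          N * (q.2 : ℝ) / (q.1.1.2 : ℝ) ^ 2 :=
        Continuous.div (by fun_prop) (by fun_prop) fun q => pow_ne_zero 2 (hne q)
      unfold wiggleVal
      fun_prop
    convert continuous_projIcc.comp hc using 1
    funext q
    exact wiggle_apply N _ q.1.2 _

lemma exists_infConv_eq_self (f : C(I, I)) {L : ℝ} (hL : 0 ≤ L) : ∃ x, infConv f L x = x := by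
  have hmem : ∀ x, infConv f L x ∈ I := fun x =>
    ⟨infConv_nonneg f hL x, (infConv_le_self f hL x).trans (f x).2.2⟩
  have hc : Continuous fun x => (⟨infConv f L x, hmem x⟩ : I) :=
    (continuous_infConv (f := fun _ : I => f) (L := fun _ => L) (x := id)
      continuous_const continuous_const continuous_id fun _ => hL).subtype_mk _
  obtain ⟨x, -, hx⟩ := exists_mem_Icc_isFixedPt_of_mapsTo (a := (0 : I)) (b := 1)
    (f := fun x => (⟨infConv f L x, hmem x⟩ : I)) hc.continuousOn zero_le_one
    (fun x _ => ⟨(hmem x).1, (hmem x).2⟩)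
  exact ⟨x, congrArg Subtype.val hx⟩

/-- Near a fixed point of the regularized map the slope `t⁻¹` moves values by at most `t` over a
length `t ^ 2`, so the amplitude `4 * t` dominates both that drift and the length `t ^ 2 ≤ t`. -/
lemma exists_interval_overshoot (M : ℕ) (f : C(I, I)) {t : I} (ht : 0 < t) :
    ∃ l : ℝ, 0 ≤ l ∧ l + (t : ℝ) ^ 2 ≤ 1 ∧ ∀ x : I, l ≤ x → (x : ℝ) ≤ l + (t : ℝ) ^ 2 →
      ((Real.cos (M * x / (t : ℝ) ^ 2 * Real.pi) = 1 → l + (t : ℝ) ^ 2 ≤ wiggle M (f, t) x) ∧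
      (Real.cos (M * x / (t : ℝ) ^ 2 * Real.pi) = -1 → (wiggle M (f, t) x : ℝ) ≤ l)) := by
  have ht' : (0 : ℝ) < t := ht
  have hti : 0 ≤ (t : ℝ)⁻¹ := by positivity
  have ht1 : (t : ℝ) ^ 2 ≤ t := by nlinarith [t.2.2]
  obtain ⟨x₀, hx₀⟩ := exists_infConv_eq_self f hti
  -- This left end point gives an interval of length `t ^ 2` that contains `x₀` and fits inside `I`.
  have hl : min (x₀ : ℝ) (1 - (t : ℝ) ^ 2) ≤ x₀ := min_le_left _ _
  have hl' : (x₀ : ℝ) ≤ min (x₀ : ℝ) (1 - (t : ℝ) ^ 2) + (t : ℝ) ^ 2 := by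
    rw [← sub_le_iff_le_add]
    refine le_min ?_ ?_ <;> nlinarith [x₀.2.2]
  have hl0 : 0 ≤ min (x₀ : ℝ) (1 - (t : ℝ) ^ 2) := le_min x₀.2.1 (by linarith [t.2.2])
  have hl1 : min (x₀ : ℝ) (1 - (t : ℝ) ^ 2) ≤ 1 - (t : ℝ) ^ 2 := min_le_right _ _
  generalize min (x₀ : ℝ) (1 - (t : ℝ) ^ 2) = l at *
  refine ⟨l, hl0, by linarith, fun x hx hx' => ?_⟩
  have h1 := abs_infConv_sub_le f f hti hti x x₀
  have h2 : (t : ℝ)⁻¹ * |(x : ℝ) - x₀| ≤ t := by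
    rw [inv_mul_le_iff₀ ht', ← sq]
    exact abs_le.2 ⟨by linarith, by linarith⟩
  rw [dist_self, sub_self, abs_zero, zero_add, zero_add, hx₀] at h1
  have h3 := abs_le.1 (h1.trans h2)
  constructor
  · intro hc
    rw [wiggle_apply M f ht, coe_projIcc, wiggleVal, hc]
    refine le_max_of_le_right (le_min (by linarith) (by linarith))
  · intro hc
    rw [wiggle_apply M f ht, coe_projIcc, wiggleVal, hc]
    refine max_le hl0 (min_le_of_right_le (by linarith))

/-- Each rising or falling branch of the oscillation near the fixed point is stretched over the
whole interval. -/
theorem log_le_htop_wiggle {M : ℕ} (hM : 0 < M) (f : C(I, I)) {t : I} (ht : 0 < t) :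
    ENNReal.ofReal (Real.log M) ≤ htop (wiggle (2 * M) (f, t)) := by
  have ht' : (0 : ℝ) < t := ht
  obtain ⟨l, hl0, hl1, hover⟩ := exists_interval_overshoot (2 * M) f ht
  set T : ℝ := (t : ℝ) ^ 2 with hT
  have hT0 : 0 < T := by positivity
  have hM' : (0 : ℝ) < M := by exact_mod_cast hM
  -- Index of the first extremum of the cosine at or after `l`; it and the next `2 * M - 1` extrema
  -- lie in `[l, l + T]` and pair off into `M` disjoint branches.
  set k₀ : ℕ := ⌈2 * M * l / T⌉₊
  have hk : 2 * M * l / T ≤ k₀ := Nat.le_ceil _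
  have hk' : (k₀ : ℝ) < 2 * M * l / T + 1 := Nat.ceil_lt_add_one (by positivity)
  set e : ℕ → ℝ := fun j => T * (k₀ + j : ℕ) / (2 * M) with he
  have hemono : ∀ {i j : ℕ}, i < j → e i < e j := fun {i j} hij => by
    have : ((k₀ + i : ℕ) : ℝ) < (k₀ + j : ℕ) := by exact_mod_cast Nat.add_lt_add_left hij _
    simp only [he]
    gcongr
  have hel : ∀ j, l ≤ e j := fun j => by
    simp only [he]
    rw [div_le_iff₀ hT0] at hk
    rw [le_div_iff₀ (by positivity)]
    push_cast
    nlinarith [mul_nonneg hT0.le (Nat.cast_nonneg (α := ℝ) j)]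
  have her : ∀ j < 2 * M, e j ≤ l + T := fun j hj => by
    have hj' : (j : ℝ) + 1 ≤ 2 * M := by exact_mod_cast hj
    have h2 : (k₀ : ℝ) + j - 2 * M ≤ 2 * M * l / T := by linarith
    rw [le_div_iff₀ hT0] at h2
    simp only [he]
    rw [div_le_iff₀ (by positivity)]
    push_cast
    linarith
  have hcos : ∀ j, Real.cos ((2 * M : ℕ) * e j / T * Real.pi) = (-1) ^ (k₀ + j) := fun j => by
    rw [← Real.cos_nat_mul_pi]
    congr 2
    simp only [he]
    push_cast
    field_simp
  have heI : ∀ j < 2 * M, e j ∈ I := fun j hj =>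
    ⟨hl0.trans (hel j), (her j hj).trans hl1⟩
  have hi0 : ∀ i : Fin M, 2 * (i : ℕ) < 2 * M := fun i => by omega
  have hi1 : ∀ i : Fin M, 2 * (i : ℕ) + 1 < 2 * M := fun i => by omega
  set a : Fin M → I := fun i => ⟨e (2 * i), heI _ (hi0 i)⟩
  set b : Fin M → I := fun i => ⟨e (2 * i + 1), heI _ (hi1 i)⟩
  have hab : ∀ i, a i ≤ b i := fun i => (hemono (Nat.lt_succ_self _)).le
  have : Nonempty (Fin M) := ⟨⟨0, hM⟩⟩
  have key := le_htop_of_horseshoe (wiggle (2 * M) (f, t)) (fun i => Icc (a i) (b i))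
    (fun i => isClosed_Icc) (fun i => nonempty_Icc.2 (hab i)) ?_ one_pos ?_
  · simpa using key
  · intro i j hij
    wlog h : i < j generalizing i j
    · exact (this hij.symm (lt_of_le_of_ne (not_lt.1 h) hij.symm)).symm
    refine disjoint_left.2 fun x hx hx' => ?_
    have h1 : e (2 * i + 1) < e (2 * j) := hemono (by have : (i : ℕ) < j := h; omega)
    exact absurd (hx'.1.trans hx.2) (not_le.2 h1)
  · intro i j
    rw [Function.iterate_one]
    refine Subset.trans ?_ ((intermediate_value_uIcc
      (wiggle (2 * M) (f, t)).continuous.continuousOn).trans_eq (by rw [uIcc_of_le (hab i)]))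
    intro x hx
    have hxl : l ≤ x := (hel _).trans hx.1
    have hxr : (x : ℝ) ≤ l + T := le_trans hx.2 (her _ (hi1 j))
    have ha := hover (a i) (hel _) (her _ (hi0 i))
    have hb := hover (b i) (hel _) (her _ (hi1 i))
    rw [hcos] at ha hb
    rcases Nat.even_or_odd (k₀ + 2 * i) with hev | hodd
    · have h1 := ha.1 hev.neg_one_pow
      have h2 := hb.2 hev.add_one.neg_one_pow
      rw [uIcc_comm]
      exact Icc_subset_uIcc ⟨h2.trans hxl, hxr.trans h1⟩
    · have h1 := ha.2 hodd.neg_one_pow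
      have h2 := hb.1 hodd.add_one.neg_one_pow
      exact Icc_subset_uIcc ⟨h1.trans hxl, hxr.trans h2⟩

end Homotopy

end TopEntropy

namespace TopEntropy

/-! ### Counting itineraries -/

section Counting

variable {X ι : Type*} [Fintype ι]

open Classical in
/-- The number of words `w` of length `n` for which some orbit starting in `E` visits
`P (w 0), …, P (w (n - 1))` at times `1, …, n`. -/
noncomputable def wordCount (F : X → X) (P : ι → Set X) : ℕ → Set X → ℕ
  | 0, E => if E.Nonempty then 1 else 0
  | n + 1, E => ∑ b, wordCount F P n (F '' E ∩ P b)

open Classical in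
/-- The number of words of length `n` counted by `wordCount` whose set of end points is all of
`P B`. -/
noncomputable def fullCount (F : X → X) (P : ι → Set X) : ℕ → Set X → ι → ℕ
  | 0, E, B => if E = P B then 1 else 0
  | n + 1, E, B => ∑ b, fullCount F P n (F '' E ∩ P b) B

variable {F : X → X} {P : ι → Set X}

lemma wordCount_empty (n : ℕ) : wordCount F P n ∅ = 0 := by
  induction n with
  | zero => simp [wordCount]
  | succ n ih => simp [wordCount, ih]

lemma wordCount_zero_le (E : Set X) : wordCount F P 0 E ≤ 1 := by
  unfold wordCount
  split_ifs <;> simp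

lemma fullCount_zero_le (E : Set X) (B : ι) : fullCount F P 0 E B ≤ 1 := by
  unfold fullCount
  split_ifs <;> simp

lemma fullCount_zero_self (B : ι) : fullCount F P 0 (P B) B = 1 := by simp [fullCount]

/-- Words concatenate: after a word that ends on all of `P B`, any word from `P B` may follow. -/
lemma fullCount_mul_le (m n : ℕ) (E : Set X) (B C : ι) :
    fullCount F P m E B * fullCount F P n (P B) C ≤ fullCount F P (m + n) E C := by
  induction m generalizing E with
  | zero =>
    rw [fullCount]
    split_ifs with h
    · rw [h, one_mul, Nat.zero_add]
    · simp
  | succ m ih =>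
    rw [Nat.succ_add, fullCount, fullCount, Finset.sum_mul]
    exact Finset.sum_le_sum fun b _ => ih _

/-- The itineraries of length `n + 1` starting in `E` index a subcover of the iterated join. -/
lemma exists_cover_card_le_wordCount {α : Set (Set X)} (hP : ∀ x, ∃ b, x ∈ P b)
    (hPα : ∀ b, ∃ U ∈ α, P b ⊆ U) (n : ℕ) {E : Set X} (hE : ∃ U ∈ α, E ⊆ U) :
    ∃ s : Finset (Set X), (s : Set (Set X)) ⊆ iterJoin F α (n + 1) ∧
      E ⊆ ⋃₀ (s : Set (Set X)) ∧ s.card ≤ wordCount F P n E := by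
  classical
  induction n generalizing E with
  | zero =>
    obtain ⟨U, hU, hEU⟩ := hE
    by_cases hne : E.Nonempty
    · refine ⟨{univ ∩ F^[0] ⁻¹' U}, ?_, by simpa using hEU, by simp [wordCount, hne]⟩
      rw [Finset.coe_singleton, singleton_subset_iff]
      exact ⟨univ, rfl, _, ⟨U, hU, rfl⟩, rfl⟩
    · rw [not_nonempty_iff_eq_empty] at hne
      exact ⟨∅, by simp, by simp [hne], by simp⟩
  | succ n ih =>
    obtain ⟨U, hU, hEU⟩ := hE
    have hb : ∀ b, ∃ V ∈ α, F '' E ∩ P b ⊆ V := fun b => by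
      obtain ⟨V, hV, h⟩ := hPα b
      exact ⟨V, hV, inter_subset_right.trans h⟩
    choose s hs hsE hsc using fun b => ih (hb b)
    refine ⟨Finset.univ.biUnion fun b => (s b).image fun V => (univ ∩ F^[0] ⁻¹' U) ∩ F^[1] ⁻¹' V,
      ?_, ?_, ?_⟩
    · intro W hW
      simp only [Finset.mem_coe, Finset.mem_biUnion, Finset.mem_image] at hW
      obtain ⟨b, -, V, hV, rfl⟩ := hW
      rw [Nat.add_comm (n + 1) 1, iterJoin_add]
      exact ⟨_, ⟨univ, rfl, _, ⟨U, hU, rfl⟩, rfl⟩, _, ⟨V, hs b hV, rfl⟩, rfl⟩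
    · intro x hx
      obtain ⟨b, hxb⟩ := hP (F x)
      obtain ⟨V, hV, hxV⟩ := hsE b ⟨mem_image_of_mem F hx, hxb⟩
      refine ⟨_, Finset.mem_coe.2 (Finset.mem_biUnion.2 ⟨b, Finset.mem_univ b,
        Finset.mem_image_of_mem _ hV⟩), ⟨mem_univ _, hEU hx⟩, hxV⟩
    · refine Finset.card_biUnion_le.trans (Finset.sum_le_sum fun b _ => ?_)
      exact Finset.card_image_le.trans (hsc b)

lemma coverNumber_le_sum_wordCount {α : Set (Set X)} (hP : ∀ x, ∃ b, x ∈ P b)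
    (hPα : ∀ b, ∃ U ∈ α, P b ⊆ U) (n : ℕ) :
    coverNumber (iterJoin F α (n + 1)) ≤ ∑ b, wordCount F P n (P b) := by
  classical
  choose s hs hsE hsc using fun b => exists_cover_card_le_wordCount (F := F) hP hPα n (hPα b)
  refine (coverNumber_le (Finset.univ.biUnion s) ?_ ?_).trans
    (Finset.card_biUnion_le.trans (Finset.sum_le_sum fun b _ => hsc b))
  · intro V hV
    obtain ⟨b, -, h⟩ := Finset.mem_biUnion.1 (Finset.mem_coe.1 hV)
    exact hs b h
  · refine eq_univ_of_forall fun x => ?_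
    obtain ⟨b, hb⟩ := hP x
    obtain ⟨V, hV, hx⟩ := hsE b hb
    exact ⟨V, Finset.mem_coe.2 (Finset.mem_biUnion.2 ⟨b, Finset.mem_univ b, hV⟩), hx⟩

end Counting

/-! ### Fast growth forces self-covering -/

section Growth

variable {X ι : Type*} [Fintype ι] {F : X → X} {P : ι → Set X}

/-- `A` grows at rate more than `ν` if its words are not `O(ν ^ n)`. -/
def FastGrowing (F : X → X) (P : ι → Set X) (ν : ℝ) (A : ι) : Prop :=
  ∀ C : ℝ, ∃ n, C * ν ^ n < wordCount F P n (P A)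

open Classical in
/-- The discounted number of words from `E` covering a fast growing part. -/
noncomputable def fullSum (F : X → X) (P : ι → Set X) (ν : ℝ) (n : ℕ) (E : Set X) : ℝ :=
  ∑ k ∈ Finset.range (n + 1), ∑ B,
    if FastGrowing F P ν B then (fullCount F P k E B : ℝ) / ν ^ k else 0

lemma fullSum_nonneg {ν : ℝ} (hν : 0 ≤ ν) (n : ℕ) (E : Set X) : 0 ≤ fullSum F P ν n E := by
  unfold fullSum
  refine Finset.sum_nonneg fun k _ => Finset.sum_nonneg fun B _ => ?_
  split_ifs <;> positivity

lemma fullSum_succ {ν : ℝ} (n : ℕ) (E : Set X) :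
    fullSum F P ν (n + 1) E =
      fullSum F P ν 0 E + (∑ b, fullSum F P ν n (F '' E ∩ P b)) / ν := by
  unfold fullSum
  rw [Finset.sum_range_succ', add_comm]
  congr 1
  · simp
  · simp only [Finset.sum_div]
    refine Eq.trans (Finset.sum_congr rfl fun k _ => ?_) Finset.sum_comm
    refine Eq.trans (Finset.sum_congr rfl fun B _ => ?_) Finset.sum_comm
    split_ifs
    · rw [fullCount, Nat.cast_sum, Finset.sum_div]
      refine Finset.sum_congr rfl fun b _ => ?_
      rw [pow_succ, div_div]
    · simp

open Classical in
lemma one_le_fullSum_zero {ν : ℝ} {B : ι} (hB : FastGrowing F P ν B) :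
    1 ≤ fullSum F P ν 0 (P B) := by
  unfold fullSum
  rw [Finset.sum_range_one]
  have := Finset.single_le_sum (s := Finset.univ) (a := B)
    (f := fun B' => 
      if FastGrowing F P ν B' then (fullCount F P 0 (P B) B' : ℝ) / ν ^ 0 else 0)
    (fun i _ => by split_ifs <;> positivity) (Finset.mem_univ B)
  simpa [hB, fullCount_zero_self] using this

lemma exists_const_of_not_fastGrowing {ν : ℝ} (hν : 0 ≤ ν) :
    ∃ C : ℝ, 0 ≤ C ∧ ∀ A, ¬ FastGrowing F P ν A → ∀ n, (wordCount F P n (P A) : ℝ) ≤ C * ν ^ n := by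
  have h : ∀ A, ∃ C : ℝ, 0 ≤ C ∧
      (¬ FastGrowing F P ν A → ∀ n, (wordCount F P n (P A) : ℝ) ≤ C * ν ^ n) := by
    intro A
    by_cases hA : FastGrowing F P ν A
    · exact ⟨0, le_rfl, fun h => absurd hA h⟩
    · have := hA
      unfold FastGrowing at this
      push Not at this
      obtain ⟨C, hC⟩ := this
      refine ⟨max C 0, le_max_right _ _, fun _ n => (hC n).trans ?_⟩
      gcongr
      exact le_max_left _ _
  choose C hC0 hC using h
  refine ⟨∑ A, C A, Finset.sum_nonneg fun A _ => hC0 A, fun A hA n => (hC A hA n).trans ?_⟩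
  gcongr
  exact Finset.single_le_sum (f := C) (fun i _ => hC0 i) (Finset.mem_univ A)

open Classical in
/-- If every image meets at most two parts without containing them, words are controlled by
those that cover fast growing parts. -/
lemma wordCount_le_fullSum {ν C D : ℝ} (hν : 0 < ν) (hC0 : 0 ≤ C) (hD : 1 ≤ D)
    (hCD : Fintype.card ι * C + 2 * D ≤ D * ν)
    (hC : ∀ A, ¬ FastGrowing F P ν A → ∀ n, (wordCount F P n (P A) : ℝ) ≤ C * ν ^ n)
    (good : Set X → Prop) (hgood : ∀ E b, good E → good (F '' E ∩ P b))
    (htwo : ∀ E, good E → (Finset.univ.filter fun b =>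
      (F '' E ∩ P b).Nonempty ∧ F '' E ∩ P b ≠ P b).card ≤ 2)
    (n : ℕ) (E : Set X) (hE : good E) :
    (wordCount F P n E : ℝ) ≤ D * ν ^ n *
      ((if ∃ B, FastGrowing F P ν B ∧ E = P B then 0 else 1) + fullSum F P ν n E) := by
  have hone : ∀ E : Set X, 1 ≤
      (if ∃ B, FastGrowing F P ν B ∧ E = P B then 0 else 1) + fullSum F P ν 0 E := by
    intro E
    split_ifs with h
    · obtain ⟨B, hB, rfl⟩ := h
      rw [zero_add]
      exact one_le_fullSum_zero hB
    · linarith [fullSum_nonneg (F := F) (P := P) hν.le 0 E]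
  induction n generalizing E with
  | zero =>
    have h1 : (wordCount F P 0 E : ℝ) ≤ 1 := by exact_mod_cast wordCount_zero_le E
    rw [pow_zero, mul_one]
    exact h1.trans (one_le_mul_of_one_le_of_one_le hD (hone E))
  | succ n ih =>
    -- Letters split by type: partial ones, at most two, cost `D * ν ^ n` each; full slow ones cost
    -- `C * ν ^ n`; full fast ones are paid for by `fullSum` alone.
    set S := Finset.univ.filter fun b => (F '' E ∩ P b).Nonempty ∧ F '' E ∩ P b ≠ P b with hS
    have hstep : ∀ b, (wordCount F P n (F '' E ∩ P b) : ℝ) ≤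
        C * ν ^ n + (if b ∈ S then D * ν ^ n else 0) +
          D * ν ^ n * fullSum F P ν n (F '' E ∩ P b) := by
      intro b
      have h0 := fullSum_nonneg (F := F) (P := P) hν.le n (F '' E ∩ P b)
      have h1 : 0 ≤ C * ν ^ n := by positivity
      have h2 : 0 ≤ D * ν ^ n * fullSum F P ν n (F '' E ∩ P b) := by positivity
      have h3 : 0 ≤ if b ∈ S then D * ν ^ n else 0 := by split_ifs <;> positivity
      have hih := ih _ (hgood E b hE)
      by_cases hb : b ∈ S
      · rw [if_pos hb]
        have : (if ∃ B, FastGrowing F P ν B ∧ F '' E ∩ P b = P B then (0 : ℝ) else 1) ≤ 1 := by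
          split_ifs <;> norm_num
        nlinarith [mul_le_mul_of_nonneg_left this (show 0 ≤ D * ν ^ n by positivity)]
      · have hb' : F '' E ∩ P b = ∅ ∨ F '' E ∩ P b = P b := by
          by_contra hcon
          push Not at hcon
          exact hb (Finset.mem_filter.2 ⟨Finset.mem_univ _, hcon⟩)
        rcases hb' with hb' | hb'
        · rw [hb', wordCount_empty, ← hb', Nat.cast_zero]
          positivity
        · by_cases hfast : FastGrowing F P ν b
          · rw [if_pos ⟨b, hfast, hb'⟩, zero_add] at hih
            linarith
          · have := hC b hfast n
            rw [hb'] at h2 ⊢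
            linarith
    have hSc : (S.card : ℝ) ≤ 2 := by exact_mod_cast htwo E hE
    rw [wordCount, Nat.cast_sum]
    refine (Finset.sum_le_sum fun b _ => hstep b).trans ?_
    rw [Finset.sum_add_distrib, Finset.sum_add_distrib, Finset.sum_const, ← Finset.sum_filter,
      Finset.sum_const, ← Finset.mul_sum, Finset.filter_mem_eq_inter, Finset.univ_inter,
      nsmul_eq_mul, nsmul_eq_mul, Finset.card_univ, fullSum_succ]
    have hpow : 0 < ν ^ n := by positivity
    have e1 : D * ν ^ (n + 1) * ((∑ b, fullSum F P ν n (F '' E ∩ P b)) / ν) =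
        D * ν ^ n * ∑ b, fullSum F P ν n (F '' E ∩ P b) := by
      rw [pow_succ]
      field_simp
    have e2 : (Fintype.card ι : ℝ) * (C * ν ^ n) + S.card * (D * ν ^ n) ≤ D * ν ^ (n + 1) := by
      have : (S.card : ℝ) * D ≤ 2 * D := by gcongr
      calc _ = (Fintype.card ι * C + S.card * D) * ν ^ n := by ring
        _ ≤ (D * ν) * ν ^ n := by gcongr; linarith
        _ = _ := by ring
    have e3 := mul_le_mul_of_nonneg_left (hone E) (show 0 ≤ D * ν ^ (n + 1) by positivity)
    rw [mul_one] at e3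
    rw [← add_assoc, mul_add _ _ (_ / ν), e1]
    linarith

-- Otherwise `fullSum` is bounded by a geometric series of ratio `μ / ν`, and `wordCount_le_fullSum`
-- makes the words from `A` only `O(ν ^ n)`.
open Classical in
lemma exists_fullCount_ge {μ ν : ℝ} (hμ : 0 < μ) (hμν : μ < ν) (hν : 2 < ν)
    (good : Set X → Prop) (hgood : ∀ E b, good E → good (F '' E ∩ P b))
    (htwo : ∀ E, good E → (Finset.univ.filter fun b =>
      (F '' E ∩ P b).Nonempty ∧ F '' E ∩ P b ≠ P b).card ≤ 2)
    {A : ι} (hgA : good (P A)) (hA : FastGrowing F P ν A) :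
    ∃ B, FastGrowing F P ν B ∧ ∃ k, 0 < k ∧ μ ^ k ≤ fullCount F P k (P A) B := by
  by_contra! hcon
  have hν0 : 0 < ν := by linarith
  obtain ⟨C, hC0, hC⟩ := exists_const_of_not_fastGrowing (F := F) (P := P) hν0.le
  -- Chosen so that `card ι * C = (D - 1) * (ν - 2)`, which is where `ν > 2` is needed.
  set D : ℝ := Fintype.card ι * C / (ν - 2) + 1 with hD
  have hν2 : 0 < ν - 2 := by linarith
  have hD1 : 1 ≤ D := by
    rw [hD, le_add_iff_nonneg_left]
    positivity
  have hCD : Fintype.card ι * C + 2 * D ≤ D * ν := by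
    have : Fintype.card ι * C = (D - 1) * (ν - 2) := by rw [hD]; field_simp; ring
    nlinarith
  have hr0 : 0 ≤ μ / ν := by positivity
  have hr1 : μ / ν < 1 := (div_lt_one hν0).2 hμν
  have hsum : ∀ n, fullSum F P ν n (P A) ≤ Fintype.card ι * (1 - μ / ν)⁻¹ := by
    intro n
    unfold fullSum
    calc _ ≤ ∑ k ∈ Finset.range (n + 1), ∑ B : ι, (μ / ν) ^ k := by
          refine Finset.sum_le_sum fun k _ => Finset.sum_le_sum fun B _ => ?_
          split_ifs with hB
          · rw [div_pow]
            gcongr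
            rcases Nat.eq_zero_or_pos k with rfl | hk
            · rw [pow_zero]
              exact_mod_cast fullCount_zero_le (P A) B
            · exact (hcon B hB k hk).le
          · positivity
      _ = Fintype.card ι * ∑ k ∈ Finset.range (n + 1), (μ / ν) ^ k := by
          simp [Finset.mul_sum]
      _ ≤ _ := by
          gcongr
          rw [← tsum_geometric_of_lt_one hr0 hr1]
          exact (summable_geometric_of_lt_one hr0 hr1).sum_le_tsum _ fun k _ => by positivity
  obtain ⟨n, hn⟩ := hA (D * (1 + Fintype.card ι * (1 - μ / ν)⁻¹))
  have h := wordCount_le_fullSum hν0 hC0 hD1 hCD hC good hgood htwo n (P A) hgA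
  rw [if_pos ⟨A, hA, rfl⟩] at h
  have h2 := mul_le_mul_of_nonneg_left (hsum n) (show 0 ≤ D * ν ^ n by positivity)
  have h3 : 0 < D * ν ^ n := by positivity
  nlinarith

/-- Following successors in a finite set must revisit a point, and transitivity closes the loop. -/
lemma exists_rel_self_of_serial {α : Type*} [Finite α] [Nonempty α] {R : α → α → Prop}
    (htrans : ∀ a b c, R a b → R b c → R a c) (hser : ∀ a, ∃ b, R a b) : ∃ a, R a a := by
  choose φ hφ using hser
  set u : ℕ → α := fun n => φ^[n] (Classical.arbitrary α)
  have hstep : ∀ n, R (u n) (u (n + 1)) := fun n => by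
    simp only [u, Function.iterate_succ_apply']
    exact hφ _
  have hlt : ∀ m n, m < n → R (u m) (u n) := fun m n h => by
    induction n, h using Nat.le_induction with
    | base => exact hstep m
    | succ n _ ih => exact htrans _ _ _ ih (hstep n)
  obtain ⟨m, n, hne, he⟩ := Finite.exists_ne_map_eq_of_infinite u
  rcases lt_or_gt_of_ne hne with h | h
  · exact ⟨u m, by simpa [he] using hlt m n h⟩
  · exact ⟨u n, by simpa [he] using hlt n m h⟩

open Classical in
/-- Exponential growth of the number of words yields a part that covers itself many times. -/
theorem exists_fullCount_self_ge {μ ν : ℝ} (hμ : 0 < μ) (hμν : μ < ν) (hν : 2 < ν)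
    (good : Set X → Prop) (hgood : ∀ E b, good E → good (F '' E ∩ P b))
    (htwo : ∀ E, good E → (Finset.univ.filter fun b =>
      (F '' E ∩ P b).Nonempty ∧ F '' E ∩ P b ≠ P b).card ≤ 2)
    (hgP : ∀ A, good (P A)) (hgrow : ∀ C : ℝ, ∃ n, C * ν ^ n < ∑ b, wordCount F P n (P b)) :
    ∃ A, (P A).Nonempty ∧ ∃ k, 0 < k ∧ μ ^ k ≤ fullCount F P k (P A) A := by
  have hν0 : 0 < ν := by linarith
  have hne : Nonempty {A // FastGrowing F P ν A} := by
    by_contra hcon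
    rw [nonempty_subtype, not_exists] at hcon
    obtain ⟨C, -, hC⟩ := exists_const_of_not_fastGrowing (F := F) (P := P) hν0.le
    obtain ⟨n, hn⟩ := hgrow (Fintype.card ι * C)
    refine absurd hn (not_lt.2 ?_)
    push_cast
    calc _ ≤ ∑ _b : ι, C * ν ^ n := Finset.sum_le_sum fun b _ => hC b (hcon b) n
      _ = _ := by simp [mul_assoc]
  obtain ⟨⟨A, hA⟩, h⟩ := exists_rel_self_of_serial
    (R := fun A B : {A // FastGrowing F P ν A} =>
      ∃ k, 0 < k ∧ μ ^ k ≤ fullCount F P k (P A.1) B.1)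
    (by
      rintro A B C ⟨k, hk, h⟩ ⟨l, -, h'⟩
      refine ⟨k + l, by omega, ?_⟩
      rw [pow_add]
      calc μ ^ k * μ ^ l ≤ (fullCount F P k (P A.1) B.1 * fullCount F P l (P B.1) C.1 : ℕ) := by
            push_cast
            gcongr
        _ ≤ _ := by exact_mod_cast fullCount_mul_le (F := F) (P := P) k l (P A.1) B.1 C.1)
    (by
      rintro ⟨A, hA⟩
      obtain ⟨B, hB, h⟩ := exists_fullCount_ge hμ hμν hν good hgood htwo (hgP A) hA
      exact ⟨⟨B, hB⟩, h⟩)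
  refine ⟨A, ?_, h⟩
  by_contra hemp
  obtain ⟨n, hn⟩ := hA 0
  rw [not_nonempty_iff_eq_empty.1 hemp, wordCount_empty, zero_mul] at hn
  simp at hn

end Growth

end TopEntropy

namespace TopEntropy

/-! ### From coverings to disjoint intervals -/

section Crossing

/-- Take the last point with value `f p`, then the first later one with value `f q`; in between, the
intermediate value theorem keeps `f` inside. Mapping into the target is what lets disjointness be
pulled back. -/
lemma exists_uIcc_mapsTo_uIcc {f : I → I} (hf : Continuous f) (p q : I) :
    ∃ x ∈ uIcc p q, ∃ y ∈ uIcc p q, f x = f p ∧ f y = f q ∧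
      MapsTo f (uIcc x y) (uIcc (f p) (f q)) := by
  wlog hpq : p ≤ q generalizing p q
  · obtain ⟨y, hy, x, hx, hfy, hfx, hmaps⟩ := this q p (le_of_not_ge hpq)
    rw [uIcc_comm y x, uIcc_comm (f q)] at hmaps
    rw [uIcc_comm q p] at hx hy
    exact ⟨x, hx, y, hy, hfx, hfy, hmaps⟩
  obtain ⟨x, ⟨hx, hfx⟩, hxmax⟩ := (isCompact_Icc.inter_right
    (isClosed_singleton.preimage hf : IsClosed (f ⁻¹' {f p}))).exists_isGreatest
    ⟨p, left_mem_Icc.2 hpq, rfl⟩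
  obtain ⟨y, ⟨hy, hfy⟩, hymin⟩ := ((isCompact_Icc (a := x) (b := q)).inter_right
    (isClosed_singleton.preimage hf : IsClosed (f ⁻¹' {f q}))).exists_isLeast
    ⟨q, right_mem_Icc.2 hx.2, rfl⟩
  rw [mem_preimage, mem_singleton_iff] at hfx hfy
  rw [uIcc_of_le hpq]
  refine ⟨x, hx, y, ⟨hx.1.trans hy.1, hy.2⟩, hfx, hfy, fun z hz => ?_⟩
  rw [uIcc_of_le hy.1] at hz
  by_contra hcon
  have hor : f p ∈ uIcc (f z) (f q) ∨ f q ∈ uIcc (f p) (f z) := by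
    simp only [mem_uIcc] at hcon ⊢
    grind
  rcases hor with h | h
  · obtain ⟨z', hz', hfz'⟩ := intermediate_value_uIcc hf.continuousOn h
    rw [uIcc_of_le (hz.2.trans hy.2)] at hz'
    have h1 : z' ≤ x := hxmax ⟨⟨hx.1.trans (hz.1.trans hz'.1), hz'.2⟩, hfz'⟩
    have h2 : z = x := le_antisymm (hz'.1.trans h1) hz.1
    rw [h2, hfx] at hcon
    exact hcon left_mem_uIcc
  · rw [← hfx] at h
    obtain ⟨z', hz', hfz'⟩ := intermediate_value_uIcc hf.continuousOn h
    rw [uIcc_of_le hz.1] at hz'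
    have h1 : y ≤ z' := hymin ⟨⟨hz'.1, hz'.2.trans (hz.2.trans hy.2)⟩, hfz'⟩
    have h2 : z = y := le_antisymm hz.2 (h1.trans hz'.2)
    rw [h2, hfy] at hcon
    exact hcon right_mem_uIcc

lemma ordConnected_image {f : I → I} (hf : Continuous f) {E : Set I} (hE : E.OrdConnected) :
    (f '' E).OrdConnected :=
  isPreconnected_iff_ordConnected.1
    ((isPreconnected_iff_ordConnected.2 hE).image f hf.continuousOn)

variable {ι : Type} [Fintype ι] {F : I → I} {P : ι → Set I}

/-- Words counted by `fullCount` yield disjoint intervals whose end points can be steered to any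
two prescribed points of the target. -/
lemma exists_disjoint_intervals (hF : Continuous F) (hP : ∀ b, (P b).OrdConnected)
    (hd : Pairwise fun b b' => Disjoint (P b) (P b')) {B : ι} {c d : I} (hc : c ∈ P B)
    (hd' : d ∈ P B) (n : ℕ) {E : Set I} (hE : E.OrdConnected) :
    ∃ (κ : Type) (_ : Fintype κ) (x y : κ → I), Fintype.card κ = fullCount F P n E B ∧
      (∀ k, uIcc (x k) (y k) ⊆ E ∧ F^[n] (x k) = c ∧ F^[n] (y k) = d) ∧
      Pairwise fun k l => Disjoint (uIcc (x k) (y k)) (uIcc (x l) (y l)) := by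
  induction n generalizing E with
  | zero =>
    by_cases h : E = P B
    · refine ⟨Unit, inferInstance, fun _ => c, fun _ => d, by simp [fullCount, h], fun _ =>
        ⟨h ▸ (hP B).uIcc_subset hc hd', rfl, rfl⟩, fun k l hkl => absurd rfl hkl⟩
    · exact ⟨Empty, inferInstance, fun _ => c, fun _ => d, by simp [fullCount, h],
        fun k => k.elim, fun k => k.elim⟩
  | succ n ih =>
    choose κ hκ x' y' hcard h hdisj using
      fun b => ih (E := F '' E ∩ P b) ((ordConnected_image hF hE).inter (hP b))
    have hpull : ∀ (b : ι) (k : κ b), ∃ x y : I, uIcc x y ⊆ E ∧ F x = x' b k ∧ F y = y' b k ∧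
        MapsTo F (uIcc x y) (uIcc (x' b k) (y' b k)) := by
      intro b k
      obtain ⟨p, hp, hpx⟩ := ((h b k).1 left_mem_uIcc).1
      obtain ⟨q, hq, hqy⟩ := ((h b k).1 right_mem_uIcc).1
      obtain ⟨x, hx, y, hy, hfx, hfy, hmaps⟩ := exists_uIcc_mapsTo_uIcc hF p q
      rw [hpx, hqy] at hmaps
      exact ⟨x, y, (uIcc_subset_uIcc hx hy).trans (hE.uIcc_subset hp hq), hfx.trans hpx,
        hfy.trans hqy, hmaps⟩
    choose x y hsub hx hy hmaps using hpull
    refine ⟨Σ b, κ b, inferInstance, fun k => x k.1 k.2, fun k => y k.1 k.2, ?_, fun k =>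
      ⟨hsub _ _, ?_, ?_⟩, ?_⟩
    · rw [Fintype.card_sigma, fullCount]
      exact Finset.sum_congr rfl fun b _ => hcard b
    · rw [Function.iterate_succ_apply, hx, (h _ _).2.1]
    · rw [Function.iterate_succ_apply, hy, (h _ _).2.2]
    · rintro ⟨b, k⟩ ⟨b', k'⟩ hne
      refine disjoint_left.2 fun z hz hz' => ?_
      have h1 := hmaps _ _ hz
      have h2 := hmaps _ _ hz'
      by_cases hb : b = b'
      · subst hb
        exact disjoint_left.1 (hdisj b (i := k) (j := k') fun hk => hne (hk ▸ rfl)) h1 h2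
      · exact disjoint_left.1 (hd hb) ((h b k).1 h1).2 ((h b' k').1 h2).2

/-- An interval that covers itself many times contains a horseshoe, with two fewer branches, each
of which overshoots the whole horseshoe strictly. -/
lemma exists_strict_horseshoe (hF : Continuous F) (hP : ∀ b, (P b).OrdConnected)
    (hd : Pairwise fun b b' => Disjoint (P b) (P b')) {A : ι} (hA : (P A).Nonempty) {n : ℕ}
    (hn : 2 ≤ fullCount F P n (P A) A) :
    ∃ (κ : Type) (_ : Fintype κ) (x y : κ → I), fullCount F P n (P A) A ≤ Fintype.card κ + 2 ∧
      (Pairwise fun k l => Disjoint (uIcc (x k) (y k)) (uIcc (x l) (y l))) ∧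
      ∃ u v, (∀ k, F^[n] (x k) = u ∧ F^[n] (y k) = v) ∧
        ∀ k, u < x k ∧ u < y k ∧ x k < v ∧ y k < v := by
  classical
  set S : Set ℝ := Subtype.val '' P A with hS
  have hSne : S.Nonempty := hA.image _
  have hbelow : BddBelow S := ⟨0, by rintro _ ⟨z, -, rfl⟩; exact z.2.1⟩
  have habove : BddAbove S := ⟨1, by rintro _ ⟨z, -, rfl⟩; exact z.2.2⟩
  have hlow : ∀ z ∈ P A, sInf S ≤ (z : ℝ) := fun z hz => csInf_le hbelow ⟨z, hz, rfl⟩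
  have hupp : ∀ z ∈ P A, (z : ℝ) ≤ sSup S := fun z hz => le_csSup habove ⟨z, hz, rfl⟩
  -- Two disjoint intervals inside `P A` already give two distinct points.
  have hlt : 0 < sSup S - sInf S := by
    obtain ⟨z, hz⟩ := hA
    obtain ⟨κ, hκ, x, y, hcard, h, hdisj⟩ := exists_disjoint_intervals hF hP hd hz hz n (hP A)
    obtain ⟨i, j, hij⟩ := Fintype.exists_pair_of_one_lt_card (show 1 < Fintype.card κ by omega)
    have hne : x i ≠ x j := fun he =>
      disjoint_left.1 (hdisj hij) left_mem_uIcc (he ▸ left_mem_uIcc)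
    have hi := (h i).1 left_mem_uIcc
    have hj := (h j).1 left_mem_uIcc
    rcases lt_or_gt_of_ne hne with h' | h'
    · have h'' : (x i : ℝ) < x j := h'
      linarith [hlow _ hi, hupp _ hj]
    · have h'' : (x j : ℝ) < x i := h'
      linarith [hlow _ hj, hupp _ hi]
  obtain ⟨δ₀, hδ₀, hunif⟩ := Metric.uniformContinuous_iff.1
    (CompactSpace.uniformContinuous_of_continuous (hF.iterate n)) ((sSup S - sInf S) / 3)
    (by positivity)
  obtain ⟨δ, hδ, hδδ₀, hδS⟩ : ∃ δ > 0, δ ≤ δ₀ ∧ δ ≤ (sSup S - sInf S) / 3 :=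
    ⟨min δ₀ ((sSup S - sInf S) / 3), by positivity, min_le_left _ _, min_le_right _ _⟩
  -- The extrema of the cell need not be attained, so `u` and `v` are only `δ`-close to them; still
  -- `v - u > (sSup S - sInf S) / 3`.
  obtain ⟨_, ⟨u, hu, rfl⟩, hu'⟩ := Real.lt_sInf_add_pos hSne hδ
  obtain ⟨_, ⟨v, hv, rfl⟩, hv'⟩ := Real.add_neg_lt_sSup hSne (neg_neg_of_pos hδ)
  obtain ⟨κ, hκ, x, y, hcard, h, hdisj⟩ := exists_disjoint_intervals hF hP hd hu hv n (hP A)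
  have hfar : ∀ k, δ ≤ |(x k : ℝ) - y k| := by
    intro k
    by_contra! hcon
    have h1 := hunif (a := x k) (b := y k) (hcon.trans_le hδδ₀)
    rw [(h k).2.1, (h k).2.2, Subtype.dist_eq, Real.dist_eq, abs_lt] at h1
    linarith
  have honce : ∀ w : I, (Finset.univ.filter fun k => w ∈ uIcc (x k) (y k)).card ≤ 1 := by
    refine fun w => Finset.card_le_one.2 fun k hk l hl => ?_
    by_contra hkl
    exact disjoint_left.1 (hdisj hkl) (Finset.mem_filter.1 hk).2 (Finset.mem_filter.1 hl).2
  refine ⟨{k // u ∉ uIcc (x k) (y k) ∧ v ∉ uIcc (x k) (y k)}, inferInstance, fun k => x k,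
    fun k => y k, ?_, fun k l hkl => hdisj fun he => hkl (Subtype.ext he), u, v,
    fun k => (h k).2, ?_⟩
  · rw [← hcard, Fintype.card_subtype, ← Finset.card_univ]
    have hsub : (Finset.univ : Finset κ) ⊆
        (Finset.univ.filter fun k => u ∉ uIcc (x k) (y k) ∧ v ∉ uIcc (x k) (y k)) ∪
          ((Finset.univ.filter fun k => u ∈ uIcc (x k) (y k)) ∪
            (Finset.univ.filter fun k => v ∈ uIcc (x k) (y k))) := by
      intro k _
      simp only [Finset.mem_union, Finset.mem_filter, Finset.mem_univ, true_and]
      tauto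
    have h1 := Finset.card_le_card hsub
    have h2 := Finset.card_union_le (Finset.univ.filter fun k => u ∈ uIcc (x k) (y k))
      (Finset.univ.filter fun k => v ∈ uIcc (x k) (y k))
    have h3 := Finset.card_union_le
      (Finset.univ.filter fun k => u ∉ uIcc (x k) (y k) ∧ v ∉ uIcc (x k) (y k))
      ((Finset.univ.filter fun k => u ∈ uIcc (x k) (y k)) ∪
            (Finset.univ.filter fun k => v ∈ uIcc (x k) (y k)))
    have := honce u
    have := honce v
    omega
  -- A branch has length at least `δ`, too long to fit in `P A` to the left of `u` or to the right
  -- of `v`; avoiding both, it lies strictly between.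
  · rintro ⟨k, hku, hkv⟩
    have hx := (h k).1 left_mem_uIcc
    have hy := (h k).1 right_mem_uIcc
    have hxl := hlow _ hx
    have hyl := hlow _ hy
    have hxu := hupp _ hx
    have hyu := hupp _ hy
    have hk := hfar k
    simp only [mem_uIcc, not_or, not_and_or, not_le, ← Subtype.coe_lt_coe] at hku hkv ⊢
    rcases le_abs.1 hk with hk | hk
    · refine ⟨?_, ?_, ?_, ?_⟩ <;> rcases hku with ⟨_ | _, _ | _⟩ <;>
        rcases hkv with ⟨_ | _, _ | _⟩ <;> linarith
    · refine ⟨?_, ?_, ?_, ?_⟩ <;> rcases hku with ⟨_ | _, _ | _⟩ <;>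
        rcases hkv with ⟨_ | _, _ | _⟩ <;> linarith

end Crossing

/-! ### Grid partitions of the interval -/

section Partition

/-- Any cell strictly between the first and the last cell met by the order-connected set `T` is
contained in `T`. -/
lemma card_partly_covered_le_two {ι : Type} [Fintype ι] [LinearOrder ι] {P : ι → Set I}
    (hlt : ∀ i j, i < j → ∀ x ∈ P i, ∀ y ∈ P j, x < y) {T : Set I} (hT : T.OrdConnected)
    (S : Finset ι) (hS : ∀ b ∈ S, (T ∩ P b).Nonempty ∧ T ∩ P b ≠ P b) : S.card ≤ 2 := by
  classical
  rcases S.eq_empty_or_nonempty with rfl | hne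
  · simp
  refine (Finset.card_le_card (t := {S.min' hne, S.max' hne}) fun b hb => ?_).trans
    Finset.card_le_two
  by_contra hcon
  simp only [Finset.mem_insert, Finset.mem_singleton, not_or] at hcon
  obtain ⟨l, hlT, hl⟩ := (hS _ (S.min'_mem hne)).1
  obtain ⟨r, hrT, hr⟩ := (hS _ (S.max'_mem hne)).1
  refine (hS b hb).2 (inter_eq_right.2 fun x hx => hT.out hlT hrT ⟨?_, ?_⟩)
  · exact (hlt _ _ (lt_of_le_of_ne (S.min'_le b hb) (Ne.symm hcon.1)) l hl x hx).le
  · exact (hlt _ _ (lt_of_le_of_ne (S.le_max' b hb) hcon.2) x hx r hr).le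

/-- The part of `I` on which `⌊s * x⌋₊ = b`. -/
def gridCell (s : ℕ) (b : Fin (s + 1)) : Set I := {x | ⌊(x : ℝ) * s⌋₊ = b}

lemma exists_mem_gridCell (s : ℕ) (x : I) : ∃ b, x ∈ gridCell s b := by
  refine ⟨⟨⌊(x : ℝ) * s⌋₊, Nat.lt_succ_of_le (Nat.floor_le_of_le ?_)⟩, rfl⟩
  exact mul_le_of_le_one_left (Nat.cast_nonneg s) x.2.2

lemma floor_mul_mono (s : ℕ) {x y : I} (h : x ≤ y) : ⌊(x : ℝ) * s⌋₊ ≤ ⌊(y : ℝ) * s⌋₊ :=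
  Nat.floor_le_floor (mul_le_mul_of_nonneg_right h (Nat.cast_nonneg s))

lemma ordConnected_gridCell (s : ℕ) (b : Fin (s + 1)) : (gridCell s b).OrdConnected := by
  refine ⟨fun x hx y hy z hz => le_antisymm ?_ ?_⟩
  · exact (floor_mul_mono s hz.2).trans_eq hy
  · exact (Eq.symm hx).trans_le (floor_mul_mono s hz.1)

lemma gridCell_lt {s : ℕ} (i j : Fin (s + 1)) (hij : i < j) : ∀ x ∈ gridCell s i,
    ∀ y ∈ gridCell s j, x < y := by
  intro x hx y hy
  by_contra! hcon
  have := floor_mul_mono s hcon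
  rw [show ⌊(x : ℝ) * s⌋₊ = i from hx, show ⌊(y : ℝ) * s⌋₊ = j from hy] at this
  exact absurd (Fin.lt_def.1 hij) (not_lt.2 this)

lemma disjoint_gridCell (s : ℕ) :
    Pairwise fun b b' => Disjoint (gridCell s b) (gridCell s b') := fun _ _ hne =>
  disjoint_left.2 fun _ hx hx' => hne (Fin.ext (Eq.trans (Eq.symm hx) hx'))

lemma dist_lt_of_mem_gridCell {s : ℕ} (hs : 0 < s) {b : Fin (s + 1)} {x y : I}
    (hx : x ∈ gridCell s b) (hy : y ∈ gridCell s b) : dist x y < 1 / s := by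
  have hs' : (0 : ℝ) < s := by exact_mod_cast hs
  have h := Nat.floor_le (mul_nonneg x.2.1 hs'.le)
  have h' := Nat.lt_floor_add_one ((x : ℝ) * s)
  have h1 := Nat.floor_le (mul_nonneg y.2.1 hs'.le)
  have h1' := Nat.lt_floor_add_one ((y : ℝ) * s)
  rw [show ⌊(x : ℝ) * s⌋₊ = b from hx] at h h'
  rw [show ⌊(y : ℝ) * s⌋₊ = b from hy] at h1 h1'
  rw [Subtype.dist_eq, Real.dist_eq, lt_div_iff₀ hs', ← abs_of_pos hs', ← abs_mul,
    abs_lt]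
  constructor <;> linarith

lemma exists_gridCell_subordinate {α : Set (Set I)} (hα : IsOpenCover α) :
    ∃ s : ℕ, ∀ b : Fin (s + 1), ∃ U ∈ α, gridCell s b ⊆ U := by
  obtain ⟨δ, hδ, hleb⟩ := lebesgue_number_lemma_of_metric_sUnion isCompact_univ hα.1 hα.2.ge
  obtain ⟨s, hs⟩ := exists_nat_one_div_lt hδ
  refine ⟨s + 1, fun b => ?_⟩
  rcases (gridCell (s + 1) b).eq_empty_or_nonempty with h | ⟨x, hx⟩
  · obtain ⟨U, hU, -⟩ := hleb 0 (mem_univ _)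
    exact ⟨U, hU, h ▸ empty_subset U⟩
  · obtain ⟨U, hU, hball⟩ := hleb x (mem_univ _)
    refine ⟨U, hU, fun y hy => hball ((dist_lt_of_mem_gridCell s.succ_pos hy hx).trans ?_)⟩
    exact_mod_cast hs

end Partition

/-! ### Lower semicontinuity of entropy -/

section Semicontinuity

lemma exists_exp_le_coverNumber {f : C(I, I)} {a : ℝ≥0} (h : (a : ℝ≥0∞) < htop f) :
    ∃ α : Set (Set I), IsOpenCover α ∧ ∃ c : ℝ, a < c ∧ ∃ n₀ : ℕ, ∀ n ≥ n₀,
      Real.exp (c * n) ≤ coverNumber (iterJoin f α n) := by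
  obtain ⟨α, hα, hlt⟩ : ∃ α, ∃ _ : IsOpenCover α, (a : ℝ≥0∞) < entropyCover f α := by
    simpa only [htop, lt_iSup_iff] using h
  obtain ⟨c, hac, hc⟩ := ENNReal.lt_iff_exists_nnreal_btwn.1 hlt
  refine ⟨α, hα, c, by exact_mod_cast hac, ?_⟩
  have hev := (tendsto_entropyCover f hα).eventually (lt_mem_nhds hc)
  obtain ⟨n₀, hn₀⟩ := eventually_atTop.1 hev
  refine ⟨max n₀ 1, fun n hn => ?_⟩
  have h1 := hn₀ n ((le_max_left _ _).trans hn)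
  have hn' : (0 : ℝ) < n := by exact_mod_cast (le_max_right n₀ 1).trans hn
  rw [← ENNReal.ofReal_coe_nnreal, ENNReal.ofReal_lt_ofReal_iff', lt_div_iff₀ hn'] at h1
  have hpos : (0 : ℝ) < coverNumber (iterJoin f α n) := by
    exact_mod_cast coverNumber_pos (hα.iterJoin f.continuous n)
  rw [← Real.le_log_iff_exp_le hpos]
  exact h1.1.le

lemma exists_strict_horseshoe_of_lt_htop {f : C(I, I)} {a : ℝ≥0} (h : (a : ℝ≥0∞) < htop f) :
    ∃ N : ℕ, 0 < N ∧ ∃ (κ : Type) (_ : Fintype κ) (x y : κ → I),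
      Real.exp (a * N) < Fintype.card κ ∧
      (Pairwise fun k l => Disjoint (uIcc (x k) (y k)) (uIcc (x l) (y l))) ∧
      ∀ i j, f^[N] (x i) < x j ∧ f^[N] (x i) < y j ∧ x j < f^[N] (y i) ∧ y j < f^[N] (y i) := by
  classical
  obtain ⟨α, hα, c, hac, n₀, hn₀⟩ := exists_exp_le_coverNumber h
  have hca : 0 < c - a := sub_pos.2 hac
  -- Makes `exp (c * k) > 6 * q`. Words then outgrow `(5 * q) ^ n`, self-coverings reach `(4 * q) ^
  -- n ≥ 4 * q ^ n`, and more than `q ^ n` remain after losing two branches.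
  obtain ⟨k, hk⟩ := exists_nat_gt (Real.log 6 / (c - a))
  have hk0 : 0 < k := by
    have : (0 : ℝ) < k := 
      lt_trans (div_pos (Real.log_pos (by norm_num)) hca) hk
    exact_mod_cast this
  set q : ℝ := Real.exp (a * k) with hq
  have hq1 : 1 ≤ q := Real.one_le_exp (by positivity)
  have hΛ : 6 * q < Real.exp (c * k) := by
    rw [div_lt_iff₀ hca] at hk
    rw [← Real.exp_log (show (0 : ℝ) < 6 by norm_num), hq, ← Real.exp_add]
    exact Real.exp_lt_exp.2 (by linarith)
  obtain ⟨s, hs⟩ := exists_gridCell_subordinate (hα.iterJoin f.continuous k)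
  set F : I → I := f^[k] with hF
  have hFc : Continuous F := f.continuous.iterate k
  have hgrow : ∀ C : ℝ, ∃ n,
      C * (5 * q) ^ n < (∑ b, wordCount F (gridCell s) n (gridCell s b) : ℕ) := by
    intro C
    have hr : 1 < Real.exp (c * k) / (5 * q) := by
      rw [one_lt_div (by positivity)]
      linarith
    obtain ⟨n, hCn, hn⟩ := ((tendsto_pow_atTop_atTop_of_one_lt hr).eventually_gt_atTop C |>.and
      (eventually_ge_atTop n₀)).exists
    refine ⟨n, ?_⟩
    rw [div_pow, lt_div_iff₀ (by positivity)] at hCn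
    refine hCn.trans_le ?_
    have h1 := coverNumber_le_sum_wordCount (F := F) (exists_mem_gridCell s) hs n
    rw [hF, iterJoin_iterate] at h1
    have h2 := hn₀ (k * (n + 1)) (by nlinarith)
    calc Real.exp (c * k) ^ n = Real.exp (c * k * n) := by
          rw [← Real.exp_nat_mul]
          ring_nf
      _ ≤ Real.exp (c * (k * (n + 1) : ℕ)) := by
          refine Real.exp_le_exp.2 ?_
          push_cast
          have : 0 ≤ c * k := mul_nonneg (a.2.trans hac.le) (Nat.cast_nonneg k)
          linarith
      _ ≤ _ := h2.trans (by exact_mod_cast h1)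
  obtain ⟨A, hAne, n, hn, hcount⟩ := exists_fullCount_self_ge (F := F) (P := gridCell s)
    (μ := 4 * q) (ν := 5 * q) (by positivity) (by linarith) (by linarith) OrdConnected
    (fun E b hE => (ordConnected_image hFc hE).inter (ordConnected_gridCell s b))
    (fun E hE => card_partly_covered_le_two gridCell_lt (ordConnected_image hFc hE) _
      fun b hb => by simpa using hb)
    (ordConnected_gridCell s) hgrow
  have hqn : 1 ≤ q ^ n := one_le_pow₀ hq1
  have h4 : (4 : ℝ) ≤ 4 ^ n := le_self_pow₀ (by norm_num) hn.ne'
  have hcount' : 4 * q ^ n ≤ fullCount F (gridCell s) n (gridCell s A) A := by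
    refine le_trans ?_ hcount
    rw [mul_pow]
    gcongr
  have htwo : 2 ≤ fullCount F (gridCell s) n (gridCell s A) A := by
    have : (2 : ℝ) ≤ fullCount F (gridCell s) n (gridCell s A) A := by linarith
    exact_mod_cast this
  obtain ⟨κ, hκ, x, y, hcard, hdisj, u, v, huv, hlt⟩ := exists_strict_horseshoe hFc
    (ordConnected_gridCell s) (disjoint_gridCell s) hAne htwo
  refine ⟨k * n, Nat.mul_pos hk0 hn, κ, hκ, x, y, ?_, hdisj, fun i j => ?_⟩
  · have h1 : (fullCount F (gridCell s) n (gridCell s A) A : ℝ) ≤ Fintype.card κ + 2 := by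
      exact_mod_cast hcard
    have h2 : Real.exp (a * (k * n : ℕ)) = q ^ n := by
      rw [hq, ← Real.exp_nat_mul]
      push_cast
      ring_nf
    rw [h2]
    linarith
  · rw [Function.iterate_mul, (huv i).1, (huv i).2]
    exact ⟨(hlt j).1, (hlt j).2.1, (hlt j).2.2.1, (hlt j).2.2.2⟩

lemma continuous_iterate_apply (N : ℕ) (z : I) : Continuous fun g : C(I, I) => g^[N] z := by
  induction N with
  | zero => exact continuous_const
  | succ N ih =>
    simp only [Function.iterate_succ_apply']
    fun_prop

/-- Topological entropy is lower semicontinuous on `C(I, I)`. -/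
theorem isOpen_Egt (a : ℝ≥0) : IsOpen (Egt (a : ℝ≥0∞)) := by
  rw [isOpen_iff_mem_nhds]
  intro f hf
  obtain ⟨N, hN, κ, hκ, x, y, hcard, hdisj, hlt⟩ := exists_strict_horseshoe_of_lt_htop hf
  have hev : ∀ᶠ g : C(I, I) in 𝓝 f, ∀ i j,
      g^[N] (x i) < x j ∧ g^[N] (x i) < y j ∧ x j < g^[N] (y i) ∧ y j < g^[N] (y i) := by
    refine eventually_all.2 fun i => eventually_all.2 fun j => ?_
    have hx := (continuous_iterate_apply N (x i)).tendsto f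
    have hy := (continuous_iterate_apply N (y i)).tendsto f
    obtain ⟨h1, h2, h3, h4⟩ := hlt i j
    exact (hx.eventually_lt_const h1).and ((hx.eventually_lt_const h2).and
      ((hy.eventually_const_lt h3).and (hy.eventually_const_lt h4)))
  filter_upwards [hev] with g hg
  have hpos : (0 : ℝ) < Fintype.card κ := (Real.exp_pos _).trans hcard
  have : Nonempty κ := Fintype.card_pos_iff.1 (by exact_mod_cast hpos)
  refine lt_of_lt_of_le ?_ (le_htop_of_horseshoe g (fun k => uIcc (x k) (y k))
    (fun k => isClosed_Icc) (fun k => nonempty_uIcc) hdisj hN fun i j => ?_)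
  · have hN' : (0 : ℝ) < N := by exact_mod_cast hN
    have h1 := (Real.lt_log_iff_exp_lt hpos).2 hcard
    have h2 : (a : ℝ) < Real.log (Fintype.card κ) / N := (lt_div_iff₀ hN').2 h1
    rw [← ENNReal.ofReal_coe_nnreal]
    exact (ENNReal.ofReal_lt_ofReal_iff (a.2.trans_lt h2)).2 h2
  · obtain ⟨h1, h2, h3, h4⟩ := hg i j
    refine Subset.trans ?_ (intermediate_value_uIcc (g.continuous.iterate N).continuousOn)
    exact uIcc_subset_uIcc (mem_uIcc.2 (Or.inl ⟨h1.le, h3.le⟩)) (mem_uIcc.2 (Or.inl ⟨h2.le, h4.le⟩))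

end Semicontinuity

end TopEntropy

/-! ### Conclusion -/

open TopEntropy in
lemma TopEntropy.exists_wiggle_mem (a : ℝ≥0) : ∃ M : ℕ, ∀ (f : C(I, I)) (t : I), 0 < t →
    wiggle M (f, t) ∈ Egt (a : ℝ≥0∞) ∩ Elt ∞ := by
  obtain ⟨M, hM⟩ := exists_nat_gt (Real.exp a)
  have hM0 : (0 : ℝ) < M := (Real.exp_pos _).trans hM
  refine ⟨2 * M, fun f t ht => ⟨?_, ?_⟩⟩
  · refine lt_of_lt_of_le ?_ (log_le_htop_wiggle (by exact_mod_cast hM0) f ht)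
    have h1 := (Real.lt_log_iff_exp_lt hM0).2 hM
    rw [← ENNReal.ofReal_coe_nnreal]
    exact (ENNReal.ofReal_lt_ofReal_iff (a.2.trans_lt h1)).2 h1
  · obtain ⟨L, hL⟩ := lipschitz_wiggle (2 * M) f ht
    exact htop_lt_top_of_lipschitz hL

theorem mainTheorem4 (a : ℝ≥0) :
    TopEntropy.HomotopyDense (TopEntropy.Ege (a : ℝ≥0∞)) ∧
    TopEntropy.HomotopyDense (TopEntropy.Egt (a : ℝ≥0∞)) ∧
    TopEntropy.HomotopyDense
      {f : TopEntropy.Elt ∞ | (f : C(I, I)) ∈ TopEntropy.Egt (a : ℝ≥0∞) ∩ TopEntropy.Elt ∞} ∧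
    IsOpen
      {f : TopEntropy.Elt ∞ | (f : C(I, I)) ∈ TopEntropy.Egt (a : ℝ≥0∞) ∩ TopEntropy.Elt ∞} := by
  obtain ⟨M, hM⟩ := TopEntropy.exists_wiggle_mem a
  have hzero := TopEntropy.wiggle_zero M
  have hcont := TopEntropy.continuous_wiggle M
  refine ⟨⟨⟨_, hcont⟩, hzero, fun f t ht =>
      show (a : ℝ≥0∞) ≤ _ from le_of_lt (hM f t ht).1⟩,
    ⟨⟨_, hcont⟩, hzero, fun f t ht => (hM f t ht).1⟩, ?_, ?_⟩
  -- The homotopy restricts to maps of finite entropy: at `t = 0` it is the identity, and afterwards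
  -- its values are Lipschitz.
  · have hmem : ∀ p : TopEntropy.Elt ∞ × I,
        TopEntropy.wiggle M (p.1, p.2) ∈ TopEntropy.Elt ∞ := by
      rintro ⟨f, t⟩
      rcases eq_or_lt_of_le (show (0 : I) ≤ t from t.2.1) with rfl | ht
      · rw [hzero]
        exact f.2
      · exact (hM f t ht).2
    exact ⟨⟨fun p => ⟨_, hmem p⟩, (hcont.comp (by fun_prop)).subtype_mk _⟩,
      fun f => Subtype.ext (hzero f), fun f t ht => hM f t ht⟩
  · convert (TopEntropy.isOpen_Egt a).preimage continuous_subtype_val using 1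
    ext f
    exact and_iff_left f.2
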